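/- Let $(\kappa_t)_{t\ge 0}$ be a Markov transition semigroup on a measurable space $S$, reversible with respect to a probability measure $\pi$, so that $T_tf(x)=\int f(y)\,\kappa_t(x,dy)$ acts on $L^2(S,\pi)$. Suppose that $T_t=e^{tQ}$ is strongly continuous, with infinitesimal generator $Q$, and that $Q$ has spectral gap $\delta>0$: the eigenvalue $0$ of $Q$ is simple (its eigenfunctions are the constants) and every other point $z$ of the spectrum of $Q$ satisfies $|z|\ge\delta$. Let $\omega=(\omega(t))_{t\in\mathbb{R}}$ be the stationary Markov process with this semigroup and with $\omega(t)\sim\pi$ for every $t$, let ${\bf P}$ be its law, and for $I\subseteq\mathbb{R}$ let $\mathcal F_I$ be the $\sigma$-algebra generated by $\{\omega(t):t\in I\}$. Let $k\ge 1$ be an integer. (1) Let $a_i<b_i$, $0\le i\le k$, be real numbers with $b_i\le a_{i+1}$ for $0\le i\le k-1$, where $a_0=-\infty$ and $b_k=\infty$ are also permitted. Let $\mathcal A_0,\dots,\mathcal A_k$ be events such that $\mathcal A_i$ is measurable with respect to $\mathcal F_{[a_i,b_i]}$ for each $i$. Then $$ {\bf P}\Big[\bigcap_{i=0}^{k}\mathcal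 A_i\Big]\le \sqrt{{\bf P}[\mathcal A_0]}\,\sqrt{{\bf P}[\mathcal A_k]}\,\prod_{i=0}^{k-1}\Big[\sqrt{{\bf P}[\mathcal A_i]}\sqrt{{\bf P}[\mathcal A_{i+1}]}+e^{-\delta(a_{i+1}-b_i)}\Big(1-\sqrt{{\bf P}[\mathcal A_i]}\sqrt{{\bf P}[\mathcal A_{i+1}]}\Big)\Big]. $$ (2) In particular, let $a<b$ be real, let $\mathcal A$ be an event on paths that is measurable with respect to $\mathcal F_{[a,b]}$, let $p={\bf P}[\mathcal A]$, let $s_0,\dots,s_k\in\mathbb{R}$, and put $t_i=s_{i+1}-s_i-(b-a)$ for $0\le i<k$. If $t_i\ge 0$ for all $0\le i<k$, then $$ {\bf P}\big[(\omega(t+s_i))_{t\in[a,b]}\in\mathcal A\ \text{ for } i=0,1,\dots,k\big]\le p\prod_{i=0}^{k-1}\big(p+e^{-\delta t_i}(1-p)\big). $$ -/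

import Mathlib

open MeasureTheory ProbabilityTheory Filter Topology
open scoped NNReal ENNReal

section Operators

variable {S : Type*} [MeasurableSpace S]

/-- A (time-homogeneous, conservative) Markov transition semigroup on `S`: Markov kernels `κ t`,
`t ≥ 0`, with `κ 0` the identity and the Chapman-Kolmogorov equations. -/
structure MarkovSemigroup (S : Type*) [MeasurableSpace S] where
  kernel : ℝ≥0 → Kernel S S
  isMarkov : ∀ t, IsMarkovKernel (kernel t)
  zero : kernel 0 = Kernel.id
  add : ∀ s t, kernel (s + t) = kernel t ∘ₖ kernel s

attribute [instance] MarkovSemigroup.isMarkov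

/-- Reversibility (detailed balance) of the semigroup with respect to `π`. -/
def MarkovSemigroup.IsReversible (K : MarkovSemigroup S) (π : Measure S) : Prop :=
  ∀ t, (K.kernel t).IsReversible π

variable {π : Measure S} [IsProbabilityMeasure π] {κ : Kernel S S} [IsMarkovKernel κ]

theorem ae_memLp_of_invariant (h : κ.Invariant π) {f : S → ℂ} (hf : MemLp f 2 π) :
    ∀ᵐ x ∂π, MemLp f 2 (κ x) := by
  have hb : π.bind κ = π := h
  have hae : AEStronglyMeasurable f π := hf.1
  have h1 : ∀ᵐ x ∂π, f =ᵐ[κ x] hae.mk f := Measure.ae_ae_of_ae_comp (by rw [hb]; exact hae.ae_eq_mk)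
  have hm : Measurable fun y => ‖hae.mk f y‖ₑ ^ (2 : ℝ) :=
    (hae.stronglyMeasurable_mk.enorm).pow_const _
  have h2 : ∫⁻ x, ∫⁻ y, ‖hae.mk f y‖ₑ ^ (2 : ℝ) ∂(κ x) ∂π < ∞ := by
    rw [← Measure.lintegral_bind κ.aemeasurable hm.aemeasurable, hb]
    have h3 : MemLp (hae.mk f) 2 π := hf.ae_eq hae.ae_eq_mk
    have := lintegral_rpow_enorm_lt_top_of_eLpNorm_lt_top (by simp) (by simp) h3.2
    simpa using this
  have h4 := ae_lt_top hm.lintegral_kernel h2.ne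
  filter_upwards [h1, h4] with x hx1 hx4
  refine MemLp.ae_eq hx1.symm ⟨hae.stronglyMeasurable_mk.aestronglyMeasurable, ?_⟩
  rw [eLpNorm_lt_top_iff_lintegral_rpow_enorm_lt_top (by simp) (by simp)]
  simpa using hx4

theorem eLpNorm_integral_kernel_le (h : κ.Invariant π) {f : S → ℂ} (hf : MemLp f 2 π) :
    eLpNorm (fun x => ∫ y, f y ∂(κ x)) 2 π ≤ eLpNorm f 2 π := by
  have hb : π.bind κ = π := h
  have hle : ∀ᵐ x ∂π, ‖∫ y, f y ∂(κ x)‖ₑ ^ (2 : ℝ) ≤ ∫⁻ y, ‖f y‖ₑ ^ (2 : ℝ) ∂(κ x) := by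
    filter_upwards [ae_memLp_of_invariant h hf] with x hx
    have h1 : ‖∫ y, f y ∂(κ x)‖ₑ ≤ eLpNorm f 2 (κ x) := by
      refine (enorm_integral_le_lintegral_enorm f).trans ?_
      rw [← eLpNorm_one_eq_lintegral_enorm]
      exact eLpNorm_le_eLpNorm_of_exponent_le (by norm_num) hx.1
    refine (ENNReal.rpow_le_rpow h1 (by norm_num)).trans (le_of_eq ?_)
    rw [eLpNorm_eq_lintegral_rpow_enorm_toReal (by simp) (by simp), ← ENNReal.rpow_mul]
    simp
  rw [eLpNorm_eq_lintegral_rpow_enorm_toReal (by simp) (by simp),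
    eLpNorm_eq_lintegral_rpow_enorm_toReal (by simp) (by simp)]
  simp only [ENNReal.toReal_ofNat]
  refine ENNReal.rpow_le_rpow ((lintegral_mono_ae hle).trans (le_of_eq ?_)) (by norm_num)
  have hm : AEMeasurable (fun y => ‖f y‖ₑ ^ (2 : ℝ)) (π.bind κ) := by
    rw [hb]; exact hf.1.enorm.pow_const _
  rw [← Measure.lintegral_bind κ.aemeasurable hm, hb]

theorem memLp_integral_kernel (h : κ.Invariant π) {f : S → ℂ} (hf : MemLp f 2 π) :
    MemLp (fun x => ∫ y, f y ∂(κ x)) 2 π := by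
  have hb : π.bind κ = π := h
  refine ⟨?_, (eLpNorm_integral_kernel_le h hf).trans_lt hf.2⟩
  have hae : AEStronglyMeasurable f (π.bind κ) := by rw [hb]; exact hf.1
  refine ⟨fun x => ∫ y, hae.mk f y ∂(κ x), hae.stronglyMeasurable_mk.integral_kernel, ?_⟩
  have h1 : ∀ᵐ x ∂π, f =ᵐ[κ x] hae.mk f := Measure.ae_ae_of_ae_comp hae.ae_eq_mk
  filter_upwards [h1] with x hx
  exact integral_congr_ae hx

/-- The Markov operator `(T f) x = ∫ f y κ(x, dy)` on the complex Hilbert space `L²(S, π)`, for a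
Markov kernel `κ` that leaves the probability measure `π` invariant. -/
noncomputable def markovOperator (κ : Kernel S S) [IsMarkovKernel κ] (π : Measure S)
    [IsProbabilityMeasure π] (h : κ.Invariant π) : Lp ℂ 2 π →L[ℂ] Lp ℂ 2 π :=
  LinearMap.mkContinuous
    { toFun := fun f => (memLp_integral_kernel h (Lp.memLp f)).toLp _
      map_add' := fun f g => by
        have hb : π.bind κ = π := h
        rw [← MemLp.toLp_add, MemLp.toLp_eq_toLp_iff]
        have h1 : ∀ᵐ x ∂π, ∀ᵐ y ∂(κ x), (f + g : Lp ℂ 2 π) y = f y + g y :=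
          Measure.ae_ae_of_ae_comp (by rw [hb]; exact Lp.coeFn_add f g)
        filter_upwards [h1, ae_memLp_of_invariant h (Lp.memLp f),
          ae_memLp_of_invariant h (Lp.memLp g)] with x hx hf hg
        rw [integral_congr_ae hx, integral_add (hf.integrable (by norm_num))
          (hg.integrable (by norm_num))]
        rfl
      map_smul' := fun c f => by
        have hb : π.bind κ = π := h
        rw [RingHom.id_apply, ← MemLp.toLp_const_smul, MemLp.toLp_eq_toLp_iff]
        have h1 : ∀ᵐ x ∂π, ∀ᵐ y ∂(κ x), (c • f : Lp ℂ 2 π) y = c • f y :=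
          Measure.ae_ae_of_ae_comp (by rw [hb]; exact Lp.coeFn_smul c f)
        filter_upwards [h1] with x hx
        rw [integral_congr_ae hx, integral_smul]
        rfl }
    1 (fun f => by
      rw [one_mul, LinearMap.coe_mk, AddHom.coe_mk, Lp.norm_toLp, Lp.norm_def]
      exact ENNReal.toReal_mono (Lp.eLpNorm_ne_top f)
        (eLpNorm_integral_kernel_le h (Lp.memLp f)))

/-- The operators `T_t`, `t ≥ 0`, on `L²(S, π)` of a reversible Markov semigroup. -/
noncomputable def MarkovSemigroup.operator (K : MarkovSemigroup S) (π : Measure S)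
    [IsProbabilityMeasure π] (h : K.IsReversible π) (t : ℝ≥0) : Lp ℂ 2 π →L[ℂ] Lp ℂ 2 π :=
  markovOperator (K.kernel t) π (h t).invariant

end Operators

section Generator

variable {H : Type*} [NormedAddCommGroup H] [NormedSpace ℂ H]

/-- Strong continuity at time `0` of a family of operators. -/
def StronglyContinuousAtZero (T : ℝ≥0 → H →L[ℂ] H) : Prop :=
  ∀ f : H, Tendsto (fun t => T t f) (𝓝[>] 0) (𝓝 f)

/-- The domain of the infinitesimal generator: those `f` for which `(T_t f - f) / t` converges in
norm as `t ↓ 0`. -/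
def generatorDomain (T : ℝ≥0 → H →L[ℂ] H) : Submodule ℂ H where
  carrier := {f | ∃ g, Tendsto (fun t : ℝ≥0 => ((t : ℂ)⁻¹) • (T t f - f)) (𝓝[>] 0) (𝓝 g)}
  zero_mem' := ⟨0, by simp⟩
  add_mem' := by
    rintro f f' ⟨g, hg⟩ ⟨g', hg'⟩
    refine ⟨g + g', (hg.add hg').congr fun t => ?_⟩
    rw [map_add, ← smul_add]
    congr 1
    abel
  smul_mem' := by
    rintro c f ⟨g, hg⟩
    refine ⟨c • g, (hg.const_smul c).congr fun t => ?_⟩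
    rw [map_smul, ← smul_sub, smul_comm]

/-- The infinitesimal generator `Q f = lim_{t ↓ 0} (T_t f - f) / t`, an unbounded operator. -/
noncomputable def generator (T : ℝ≥0 → H →L[ℂ] H) : H →ₗ.[ℂ] H where
  domain := generatorDomain T
  toFun :=
    { toFun := fun f => Classical.choose f.2
      map_add' := fun f f' => by
        refine tendsto_nhds_unique (Classical.choose_spec (f + f').2)
          (((Classical.choose_spec f.2).add (Classical.choose_spec f'.2)).congr fun t => ?_)
        rw [Submodule.coe_add, map_add, ← smul_add]
        congr 1
        abel
      map_smul' := fun c f => by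
        refine tendsto_nhds_unique (Classical.choose_spec (c • f).2)
          (((Classical.choose_spec f.2).const_smul c).congr fun t => ?_)
        rw [Submodule.coe_smul, map_smul, ← smul_sub, smul_comm] }

/-- The spectrum of an unbounded operator `Q`: `z` lies outside it iff `z - Q`, as a map from the
domain of `Q` to the whole space, has a bounded everywhere defined two-sided inverse `R`. -/
def unboundedSpectrum (Q : H →ₗ.[ℂ] H) : Set ℂ :=
  {z | ¬ ∃ R : H →L[ℂ] H,
    (∀ g : H, ∃ f : Q.domain, (f : H) = R g ∧ z • (f : H) - Q f = g) ∧
    (∀ f : Q.domain, R (z • (f : H) - Q f) = f)}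

end Generator

/-- The generator `Q` on `L²(S, π)` has a spectral gap (of size at least) `δ` around the
eigenvalue `0`: this eigenvalue is simple, its eigenfunctions being the constants, and the rest of
the spectrum has distance at least `δ` from it. -/
structure HasSpectralGap {S : Type*} [MeasurableSpace S] {π : Measure S}
    (Q : Lp ℂ 2 π →ₗ.[ℂ] Lp ℂ 2 π) (δ : ℝ) : Prop where
  simple : ∀ f : Q.domain, Q f = 0 → ∃ c : ℂ, ((f : Lp ℂ 2 π) : S → ℂ) =ᵐ[π] fun _ => c
  gap : ∀ z ∈ unboundedSpectrum Q, z ≠ 0 → δ ≤ ‖z‖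

section StationaryPaths

variable {S Ω : Type*} [MeasurableSpace S]

/-- The sigma-algebra `F_I` generated by `X t`, `t ∈ I`. -/
@[reducible]
def pathSigma (X : ℝ → Ω → S) (I : Set ℝ) : MeasurableSpace Ω :=
  ⨆ t ∈ I, MeasurableSpace.comap (X t) inferInstance

/-- `X` is, under `P`, a two-sided stationary Markov process with transition semigroup `K` and with
law `π` at every time: for `s ∈ ℝ`, `t ≥ 0`, the conditional law of `X (s + t)` given the past
`F_(-∞, s]` is `κ_t (X s, ·)`. -/
structure IsStationaryMarkov [MeasurableSpace Ω] (K : MarkovSemigroup S) (π : Measure S)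
    (X : ℝ → Ω → S) (P : Measure Ω) : Prop where
  measurable : ∀ t, Measurable (X t)
  law : ∀ t, P.map (X t) = π
  markov : ∀ (s : ℝ) (t : ℝ≥0) (B : Set S), MeasurableSet B →
    P[(X (s + t) ⁻¹' B).indicator (fun _ => (1 : ℝ)) | pathSigma X (Set.Iic s)]
      =ᵐ[P] fun ω => (K.kernel t (X s ω)).real B

end StationaryPaths

/-!
The proof has an operator-theoretic part, which turns the spectral gap into exponential decay of
correlations, and a probabilistic part, which uses the Markov property to reduce the product bound
to correlations at two times.

*Decay.* Reversibility makes `T t` a semigroup of symmetric contractions of `L²(π)`. For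
`μ = δ / 2`, the hypothesis on the spectrum of the generator `Q` provides the resolvent
`R = (μ - Q)⁻¹`. It is a positive bounded operator, whose spectrum lies in
`[0, (μ + δ)⁻¹] ∪ {μ⁻¹}`, because the spectra of `R` and `Q` correspond under `z ↦ (μ - z)⁻¹`. The
point `μ⁻¹` is therefore isolated, its spectral projection has values in the kernel of `Q`, i.e. in
the constants, and the functional calculus for `R` gives `⟪f, Q f⟫ ≤ -δ ‖f‖ ^ 2` for `f` in the
domain and orthogonal to the constants (`re_inner_generator_le`). Integration along the orbit
`t ↦ T t f` and density of the domain give `‖T t f‖ ≤ exp (-δ t) ‖f‖` for all `f` orthogonal to the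
constants (`norm_apply_le`).

*Correlations.* Let `g` depend on the path before `b` and `h` on the path after `a ≥ b`. By the
Markov property, the mean of `g h` is `⟪ψ, T (a - b) φ⟫`, where `ψ` and `φ` are the conditional
expectations of `g` and `h` given the positions at times `b` and `a`; hence
`E[g h] ≤ (1 - r) E[g] E[h] + r ‖g‖ ‖h‖` with `r = exp (-δ (a - b))` (`lintegral_mul_le`). If `g`
and `h` vanish outside `A` and `B`, then `E[g] ≤ √P(A) ‖g‖` and `E[h] ≤ √P(B) ‖h‖`, so
`E[g h] ≤ c ‖g‖ ‖h‖`, where `c = √P(A) √P(B) + r (1 - √P(A) √P(B))` is a factor of the asserted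
product.

*Product.* By induction on the number of events, the mean of `g 1_{A₀ ∩ ⋯ ∩ Aₖ}` is at most
`‖g 1_{A₀}‖ √P(Aₖ)` times the product of the factors `c`, for every `g` that depends on the path up
to the end of the first interval (`lintegral_mul_indicator_iInter_le`). In the inductive step
`g 1_{A₀}` is replaced by its conditional expectation `ψ` given the position at the beginning of the
next interval; the two-event bound for `g 1_{A₀}` and `ψ 1_{A₁}` shows
`‖ψ 1_{A₁}‖ ≤ c ‖g 1_{A₀}‖`. For shifted copies of one event the bound takes the second form of the
theorem, since the law of the process is invariant under time shifts.
-/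

/-! ### Symmetric contraction semigroups and the spectral gap of the generator -/

section SemigroupDecay

open scoped InnerProductSpace

variable {H : Type*} [NormedAddCommGroup H] [InnerProductSpace ℂ H]

/-- `T` is a strongly continuous semigroup of symmetric contractions. -/
structure IsSymmetricContractionSemigroup (T : ℝ≥0 → H →L[ℂ] H) : Prop where
  zero : ∀ f, T 0 f = f
  add : ∀ s t f, T (s + t) f = T s (T t f)
  norm_le : ∀ t f, ‖T t f‖ ≤ ‖f‖
  symm : ∀ t f g, ⟪T t f, g⟫_ℂ = ⟪f, T t g⟫_ℂ
  cont : StronglyContinuousAtZero T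

variable {T : ℝ≥0 → H →L[ℂ] H}

theorem tendsto_generator (f : (generator T).domain) :
    Tendsto (fun t : ℝ≥0 => ((t : ℂ)⁻¹) • (T t (f : H) - f)) (𝓝[>] 0) (𝓝 (generator T f)) :=
  Classical.choose_spec f.2

theorem generator_eq_of_tendsto {f g : H}
    (h : Tendsto (fun t : ℝ≥0 => ((t : ℂ)⁻¹) • (T t f - f)) (𝓝[>] 0) (𝓝 g)) :
    ∃ hf : f ∈ (generator T).domain, generator T ⟨f, hf⟩ = g :=
  ⟨⟨g, h⟩, tendsto_nhds_unique (tendsto_generator (T := T) ⟨f, ⟨g, h⟩⟩) h⟩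

theorem generator_fixed {e : H} (he : ∀ t, T t e = e) :
    ∃ hf : e ∈ (generator T).domain, generator T ⟨e, hf⟩ = 0 :=
  generator_eq_of_tendsto (by simp [he])

namespace IsSymmetricContractionSemigroup

theorem generator_symm (hT : IsSymmetricContractionSemigroup T) (f g : (generator T).domain) :
    ⟪generator T f, (g : H)⟫_ℂ = ⟪(f : H), generator T g⟫_ℂ := by
  refine tendsto_nhds_unique ((tendsto_generator f).inner tendsto_const_nhds)
    ((tendsto_const_nhds.inner (tendsto_generator g)).congr fun t => ?_)
  rw [inner_smul_left, inner_smul_right, inner_sub_left, inner_sub_right, hT.symm]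
  simp

theorem re_inner_generator_nonpos (hT : IsSymmetricContractionSemigroup T)
    (f : (generator T).domain) : (⟪(f : H), generator T f⟫_ℂ).re ≤ 0 := by
  refine le_of_tendsto ((Complex.continuous_re.tendsto _).comp
    (tendsto_const_nhds.inner (tendsto_generator f))) (Eventually.of_forall fun t => ?_)
  have h1 : (⟪(f : H), T t f⟫_ℂ).re ≤ ‖(f : H)‖ ^ 2 := by
    refine (Complex.re_le_norm _).trans ((norm_inner_le_norm _ _).trans ?_)
    rw [sq]
    exact mul_le_mul_of_nonneg_left (hT.norm_le t f) (norm_nonneg _)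
  have h2 : (⟪(f : H), (f : H)⟫_ℂ).re = ‖(f : H)‖ ^ 2 := inner_self_eq_norm_sq (𝕜 := ℂ) _
  rw [Function.comp_apply, inner_smul_right, inner_sub_right]
  have h3 : ((t : ℂ)⁻¹) = (((t : ℝ)⁻¹ : ℝ) : ℂ) := by simp
  rw [h3, Complex.re_ofReal_mul, Complex.sub_re, h2]
  exact mul_nonpos_of_nonneg_of_nonpos (by positivity) (by linarith)

theorem generator_apply (hT : IsSymmetricContractionSemigroup T) (f : (generator T).domain)
    (t : ℝ≥0) : ∃ hf : T t (f : H) ∈ (generator T).domain,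
      generator T ⟨T t f, hf⟩ = T t (generator T f) := by
  refine generator_eq_of_tendsto ((((T t).continuous.tendsto _).comp
    (tendsto_generator f)).congr fun s => ?_)
  rw [Function.comp_apply, map_smul, map_sub, ← hT.add, ← hT.add, add_comm]

theorem continuous_apply (hT : IsSymmetricContractionSemigroup T) (f : H) :
    Continuous fun t => T t f := by
  have h0 : Tendsto (fun t => T t f) (𝓝 0) (𝓝 f) := by
    have h := hT.cont f
    have h1 : ContinuousWithinAt (fun t => T t f) (Set.Ioi 0) 0 := by
      unfold ContinuousWithinAt
      simpa only [hT.zero] using h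
    have h2 : ContinuousAt (fun t => T t f) 0 := by
      rw [← continuousWithinAt_univ]
      refine (continuousWithinAt_insert_self.2 h1).mono fun t _ => ?_
      rcases eq_or_lt_of_le (zero_le (a := t)) with h | h
      · exact Or.inl h.symm
      · exact Or.inr h
    simpa [ContinuousAt, hT.zero] using h2
  rw [continuous_iff_continuousAt]
  intro s
  -- For `v = u + w`, the difference is the image of `f - T w f` under the contraction `T u`.
  have key : ∀ u v : ℝ≥0, ‖T u f - T v f‖ ≤ ‖T (nndist u v) f - f‖ := by
    have aux : ∀ u v : ℝ≥0, u ≤ v → ‖T u f - T v f‖ ≤ ‖T (nndist u v) f - f‖ := by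
      intro u v huv
      obtain ⟨w, rfl⟩ := exists_add_of_le huv
      have h1 : nndist u (u + w) = w := by
        ext; simp [NNReal.dist_eq]
      rw [h1, hT.add, ← map_sub, norm_sub_rev (T w f) f]
      exact hT.norm_le _ _
    intro u v
    rcases le_total u v with h | h
    · exact aux u v h
    · rw [norm_sub_rev, nndist_comm]; exact aux v u h
  unfold ContinuousAt
  rw [tendsto_iff_norm_sub_tendsto_zero]
  refine squeeze_zero (fun _ => norm_nonneg _) (fun u => key u s) ?_
  have h1 : Tendsto (fun u : ℝ≥0 => nndist u s) (𝓝 s) (𝓝 0) := by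
    have : Continuous fun u : ℝ≥0 => nndist u s := by fun_prop
    simpa using this.tendsto s
  exact tendsto_iff_norm_sub_tendsto_zero.1 (h0.comp h1)

theorem hasDerivWithinAt_apply (hT : IsSymmetricContractionSemigroup T)
    (f : (generator T).domain) {x : ℝ} (hx : 0 ≤ x) :
    HasDerivWithinAt (fun t : ℝ => T t.toNNReal (f : H)) (T x.toNNReal (generator T f))
      (Set.Ici x) x := by
  rw [hasDerivWithinAt_iff_tendsto_slope, Set.Ici_sdiff_left]
  have h1 : Tendsto (fun z : ℝ => (z - x).toNNReal) (𝓝[>] x) (𝓝[>] 0) := by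
    refine tendsto_nhdsWithin_iff.2 ⟨?_, ?_⟩
    · have : Continuous fun z : ℝ => (z - x).toNNReal := by fun_prop
      simpa using (this.tendsto x).mono_left nhdsWithin_le_nhds
    · filter_upwards [self_mem_nhdsWithin] with z hz
      simpa using hz
  refine (((T x.toNNReal).continuous.tendsto _).comp
    ((tendsto_generator f).comp h1)).congr' ?_
  filter_upwards [self_mem_nhdsWithin] with z (hz : x < z)
  have h2 : z.toNNReal = x.toNNReal + (z - x).toNNReal := by
    rw [← Real.toNNReal_add hx (by linarith)]; congr 1; ring
  have h3 : ((((z - x).toNNReal : ℝ≥0) : ℂ)⁻¹) = (((z - x)⁻¹ : ℝ) : ℂ) := by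
    have : (((z - x).toNNReal : ℝ≥0) : ℝ) = z - x := Real.coe_toNNReal _ (by linarith)
    rw [Complex.ofReal_inv, ← congrArg Complex.ofReal this]
  simp only [Function.comp_apply, slope_def_module]
  rw [h2, hT.add, h3, map_smul, map_sub, Complex.coe_smul]

/-- A dissipativity estimate for the generator along one orbit is a decay estimate for that
orbit: the right derivative of `exp (2 δ t) ‖T t f‖ ^ 2` is nonpositive. -/
theorem norm_apply_le_of_dissipative (hT : IsSymmetricContractionSemigroup T) {δ : ℝ}
    (f : (generator T).domain)
    (hd : ∀ t, ∀ g : (generator T).domain, (g : H) = T t f →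
      (⟪(g : H), generator T g⟫_ℂ).re ≤ -δ * ‖(g : H)‖ ^ 2) (t : ℝ≥0) :
    ‖T t (f : H)‖ ≤ Real.exp (-δ * t) * ‖(f : H)‖ := by
  let _ : InnerProductSpace ℝ H := InnerProductSpace.complexToReal
  have hcont : Continuous fun x : ℝ => Real.exp (2 * δ * x) * ‖T x.toNNReal (f : H)‖ ^ 2 := by
    have := (hT.continuous_apply (f : H)).comp continuous_real_toNNReal
    exact (by fun_prop : Continuous fun x : ℝ => Real.exp (2 * δ * x)).mul (this.norm.pow 2)
  have hderiv : ∀ x ∈ Set.Ico (0 : ℝ) t, HasDerivWithinAt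
      (fun x : ℝ => Real.exp (2 * δ * x) * ‖T x.toNNReal (f : H)‖ ^ 2)
      (Real.exp (2 * δ * x) * (2 * δ) * ‖T x.toNNReal (f : H)‖ ^ 2 + Real.exp (2 * δ * x) *
        (2 * ⟪T x.toNNReal (f : H), T x.toNNReal (generator T f)⟫_ℝ)) (Set.Ici x) x := by
    intro x hx
    have h1 := (hT.hasDerivWithinAt_apply f hx.1).norm_sq
    have h2 : HasDerivAt (fun x : ℝ => Real.exp (2 * δ * x)) (Real.exp (2 * δ * x) * (2 * δ)) x := by
      simpa using ((hasDerivAt_id x).const_mul (2 * δ)).exp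
    exact h2.hasDerivWithinAt.mul h1
  have hle := image_le_of_deriv_right_le_deriv_boundary (a := 0) (b := (t : ℝ))
    (B := fun _ => ‖(f : H)‖ ^ 2) (B' := fun _ => 0) hcont.continuousOn hderiv
    (by simp [hT.zero]) continuousOn_const (fun x _ => hasDerivWithinAt_const _ _ _)
    (fun x hx => by
      obtain ⟨hf, hQ⟩ := hT.generator_apply f x.toNNReal
      have h1 := hd x.toNNReal ⟨_, hf⟩ rfl
      rw [hQ] at h1
      have h2 : ⟪T x.toNNReal (f : H), T x.toNNReal (generator T f)⟫_ℝ
          = (⟪T x.toNNReal (f : H), T x.toNNReal (generator T f)⟫_ℂ).re := rfl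
      rw [h2]
      have := Real.exp_pos (2 * δ * x)
      simp only at h1
      nlinarith) ⟨t.coe_nonneg, le_rfl⟩
  beta_reduce at hle
  rw [Real.toNNReal_coe] at hle
  have h3 : Real.exp (2 * δ * t) = Real.exp (δ * t) ^ 2 := by
    rw [← Real.exp_nat_mul]; congr 1; push_cast; ring
  rw [h3, ← mul_pow] at hle
  have h4 := (pow_le_pow_iff_left₀ (by positivity) (norm_nonneg _) two_ne_zero).1 hle
  rw [neg_mul, Real.exp_neg, inv_mul_eq_div, le_div_iff₀ (Real.exp_pos _), mul_comm]
  exact h4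

theorem resolvent_symm (hT : IsSymmetricContractionSemigroup T) {μ : ℝ} {R : H →L[ℂ] H}
    (hR : ∀ g : H, ∃ f : (generator T).domain, (f : H) = R g ∧
      (μ : ℂ) • (f : H) - generator T f = g) (g h : H) : ⟪R g, h⟫_ℂ = ⟪g, R h⟫_ℂ := by
  obtain ⟨f, hf, hg⟩ := hR g
  obtain ⟨f', hf', hh⟩ := hR h
  rw [← hf, ← hf', ← hg, ← hh, inner_sub_left, inner_sub_right, inner_smul_left,
    inner_smul_right, hT.generator_symm]
  simp

theorem resolvent_nonneg [CompleteSpace H] (hT : IsSymmetricContractionSemigroup T) {μ : ℝ}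
    (hμ : 0 < μ) {R : H →L[ℂ] H}
    (hR : ∀ g : H, ∃ f : (generator T).domain, (f : H) = R g ∧
      (μ : ℂ) • (f : H) - generator T f = g) : 0 ≤ R := by
  rw [ContinuousLinearMap.nonneg_iff_isPositive]
  refine ⟨fun g h => hT.resolvent_symm hR g h, fun g => ?_⟩
  obtain ⟨f, hf, hg⟩ := hR g
  rw [ContinuousLinearMap.reApplyInnerSelf_apply, ← hf, ← hg, inner_sub_right, inner_smul_right]
  have h1 := hT.re_inner_generator_nonpos f
  have h2 : (⟪(f : H), (f : H)⟫_ℂ).re = ‖(f : H)‖ ^ 2 := inner_self_eq_norm_sq (𝕜 := ℂ) _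
  rw [RCLike.re_to_complex, Complex.sub_re, Complex.re_ofReal_mul, h2]
  nlinarith [sq_nonneg ‖(f : H)‖]

/-- A nonzero point `w` of the spectrum of the resolvent `R = (μ - Q)⁻¹` is `(μ - z)⁻¹` for a point
`z` of the spectrum of `Q`: if `z = μ - w⁻¹` has the resolvent `R'`, then `w - R` has the inverse
`w⁻¹ + w⁻² R'`. -/
theorem isUnit_sub_resolvent {μ w : ℂ} (hw : w ≠ 0) {R R' : H →L[ℂ] H}
    (hR : ∀ g : H, ∃ f : (generator T).domain, (f : H) = R g ∧
      μ • (f : H) - generator T f = g)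
    (hR2 : ∀ f : (generator T).domain, R (μ • (f : H) - generator T f) = f)
    (hR' : ∀ g : H, ∃ f : (generator T).domain, (f : H) = R' g ∧
      (μ - w⁻¹) • (f : H) - generator T f = g)
    (hR2' : ∀ f : (generator T).domain, R' ((μ - w⁻¹) • (f : H) - generator T f) = f) :
    IsUnit (algebraMap ℂ (H →L[ℂ] H) w - R) := by
  refine ⟨⟨algebraMap ℂ (H →L[ℂ] H) w - R, w⁻¹ • 1 + (w⁻¹ * w⁻¹) • R', ?_, ?_⟩, rfl⟩
  · ext g
    obtain ⟨f, hf, hg⟩ := hR' g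
    have h1 : μ • (f : H) - generator T f = g + w⁻¹ • (f : H) := by
      rw [← hg, sub_smul]; abel
    have h2 := hR2 f
    rw [h1, map_add, map_smul] at h2
    have h3 : R g = f - w⁻¹ • R f := eq_sub_of_add_eq h2
    simp only [mul_apply_eq_comp, add_apply,
      sub_apply, smul_apply,
      one_apply_eq_self, ContinuousLinearMap.algebraMap_apply, map_add, map_smul,
      ← hf, h3]
    match_scalars <;> field_simp <;> ring
  · ext g
    obtain ⟨f, hf, hg⟩ := hR g
    have h1 : (μ - w⁻¹) • (f : H) - generator T f = g - w⁻¹ • (f : H) := by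
      rw [← hg, sub_smul]; abel
    have h2 := hR2' f
    rw [h1, map_sub, map_smul] at h2
    have h3 : R' g = f + w⁻¹ • R' f := eq_add_of_sub_eq h2
    simp only [mul_apply_eq_comp, add_apply,
      sub_apply, smul_apply,
      one_apply_eq_self, ContinuousLinearMap.algebraMap_apply, map_sub, map_smul,
      ← hf, h3]
    match_scalars <;> field_simp <;> ring

section Gap

variable [CompleteSpace H] {δ : ℝ} {e : H}

/-- The spectral gap of `Q`, transported to the resolvent at `μ = δ / 2`. -/
theorem exists_resolvent (hT : IsSymmetricContractionSemigroup T) (hδ : 0 < δ)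
    (hgap : ∀ z ∈ unboundedSpectrum (generator T), z ≠ 0 → δ ≤ ‖z‖) :
    ∃ R : H →L[ℂ] H, 0 ≤ R ∧
      (∀ g : H, ∃ f : (generator T).domain, (f : H) = R g ∧
        ((δ / 2 : ℝ) : ℂ) • (f : H) - generator T f = g) ∧
      (∀ f : (generator T).domain, R (((δ / 2 : ℝ) : ℂ) • (f : H) - generator T f) = f) ∧
      ∀ w ∈ spectrum ℝ R, 0 ≤ w ∧ (w ≤ (δ / 2 + δ)⁻¹ ∨ w = (δ / 2)⁻¹) := by
  have hres : ∀ z : ℝ, z ≠ 0 → |z| < δ → (z : ℂ) ∉ unboundedSpectrum (generator T) :=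
    fun z hz hzδ hmem => by
      have := hgap z hmem (by exact_mod_cast hz)
      rw [Complex.norm_real, Real.norm_eq_abs] at this
      linarith
  obtain ⟨R, hR, hR2⟩ := not_not.1
    (hres (δ / 2) (by positivity) (by rw [abs_of_pos (by positivity)]; linarith))
  have hpos := hT.resolvent_nonneg (by positivity : 0 < δ / 2) hR
  refine ⟨R, hpos, hR, hR2, fun w hw => ?_⟩
  refine ⟨spectrum_nonneg_of_nonneg hpos hw, ?_⟩
  by_contra! hcon
  obtain ⟨h1, h2⟩ := hcon
  have hw0 : 0 < w := lt_trans (by positivity) h1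
  have h3 : w⁻¹ < δ / 2 + δ := inv_lt_of_inv_lt₀ (by positivity) h1
  have h4 : δ / 2 - w⁻¹ ≠ 0 := fun h => h2 (by rw [sub_eq_zero.1 h, inv_inv])
  have h5 : |δ / 2 - w⁻¹| < δ := by
    have := inv_pos.2 hw0
    rw [abs_lt]; constructor <;> linarith
  obtain ⟨R', hR', hR2'⟩ := not_not.1 (hres _ h4 h5)
  have h6 : ((δ / 2 - w⁻¹ : ℝ) : ℂ) = ((δ / 2 : ℝ) : ℂ) - (w : ℂ)⁻¹ := by push_cast; ring
  rw [h6] at hR' hR2'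
  exact hw (isUnit_sub_resolvent (w := (w : ℂ)) (Complex.ofReal_ne_zero.2 hw0.ne') hR hR2 hR' hR2')

/-- A spectral gap makes the generator dissipative with rate `δ` on the orthogonal complement of
its kernel. With `R = (μ - Q)⁻¹`, the function `x - (μ + δ) x ^ 2` is nonnegative on the spectrum
of `R` except at the isolated point `μ⁻¹`, whose spectral projection has values in the kernel. -/
theorem re_inner_generator_le (hT : IsSymmetricContractionSemigroup T) (hδ : 0 < δ)
    (he : ∀ t, T t e = e)
    (hsimple : ∀ f : (generator T).domain, generator T f = 0 → ∃ c : ℂ, (f : H) = c • e)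
    (hgap : ∀ z ∈ unboundedSpectrum (generator T), z ≠ 0 → δ ≤ ‖z‖)
    (f : (generator T).domain) (hf : ⟪e, (f : H)⟫_ℂ = 0) :
    (⟪(f : H), generator T f⟫_ℂ).re ≤ -δ * ‖(f : H)‖ ^ 2 := by
  obtain ⟨R, hpos, hR, hR2, hspec⟩ := hT.exists_resolvent hδ hgap
  have hsa : IsSelfAdjoint R := hpos.isSelfAdjoint
  set μ : ℝ := δ / 2 with hμ
  have hμ0 : 0 < μ := by positivity
  set α : ℝ := (μ + δ)⁻¹ with hα
  set β : ℝ := μ⁻¹ with hβ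
  have hα0 : 0 < α := by positivity
  have hαβ : α < β := inv_strictAnti₀ hμ0 (by linarith)
  -- On the spectrum, this continuous function is the indicator of the point `β`.
  set χ : ℝ → ℝ := fun x => max 0 ((x - α) / (β - α)) with hχ
  have hχc : Continuous χ := by fun_prop
  have hχα : ∀ x ≤ α, χ x = 0 := fun x hx =>
    max_eq_left (div_nonpos_of_nonpos_of_nonneg (by linarith) (by linarith))
  have hχβ : χ β = 1 := by
    rw [hχ]; beta_reduce; rw [div_self (by linarith), max_eq_right zero_le_one]
  set E := cfc χ R with hE
  have hREβ : ∀ x, R (E x) = β • E x := by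
    have h1 : cfc (fun x => x * χ x) R = R * E := by
      rw [cfc_mul (fun x : ℝ => x) χ R continuousOn_id hχc.continuousOn, cfc_id' ℝ R]
    have h2 : cfc (fun x => β * χ x) R = β • E := cfc_const_mul β χ R hχc.continuousOn
    have h3 : cfc (fun x => x * χ x) R = cfc (fun x => β * χ x) R := by
      refine cfc_congr fun x hx => ?_
      rcases (hspec x hx).2 with h | h
      · simp [hχα x h]
      · simp [h]
    intro x
    rw [h1, h2] at h3
    exact congrArg (fun A : H →L[ℂ] H => A x) h3
  have hEspan : ∀ x, ∃ c : ℂ, E x = c • e := by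
    intro x
    obtain ⟨d, hd, hdQ⟩ := hR (E x)
    have h1 : (μ : ℂ) • (d : H) = E x := by
      rw [hd, hREβ, Complex.coe_smul, smul_smul, hβ, mul_inv_cancel₀ hμ0.ne', one_smul]
    rw [h1, sub_eq_self] at hdQ
    obtain ⟨c, hc⟩ := hsimple d hdQ
    exact ⟨μ * c, by rw [← h1, hc, smul_smul]⟩
  have hEsa : ∀ x y, ⟪E x, y⟫_ℂ = ⟪x, E y⟫_ℂ := by
    have : IsSelfAdjoint E := cfc_predicate χ R
    exact this.isSymmetric
  have hE0 : ∀ x, ⟪e, x⟫_ℂ = 0 → E x = 0 := by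
    intro x hx
    obtain ⟨c, hc⟩ := hEspan (E x)
    have : ⟪E x, E x⟫_ℂ = 0 := by
      rw [hEsa, hc, inner_smul_right, ← inner_conj_symm, hx]; simp
    exact inner_self_eq_zero.1 this
  set p : ℝ → ℝ := fun x => x - (μ + δ) * x ^ 2 with hp
  have hpc : Continuous p := by fun_prop
  have hpR : cfc p R = R - (μ + δ) • (R * R) := by
    rw [hp, cfc_sub (fun x : ℝ => x) (fun x => (μ + δ) * x ^ 2) R, cfc_id' ℝ R,
      cfc_const_mul (μ + δ) (fun x : ℝ => x ^ 2) R, cfc_pow_id R 2, sq]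
  have hnonneg : 0 ≤ cfc (fun x => p x - p x * χ x) R := by
    refine cfc_nonneg fun x hx => ?_
    obtain ⟨h0, h | h⟩ := hspec x hx
    · have h1 : (μ + δ) * x ≤ 1 := by
        rw [hα] at h
        calc (μ + δ) * x ≤ (μ + δ) * (μ + δ)⁻¹ := by gcongr
          _ = 1 := mul_inv_cancel₀ (by positivity)
      rw [hχα x h, hp]
      nlinarith
    · rw [h, hχβ]; simp
  have hcfc : cfc (fun x => p x - p x * χ x) R = cfc p R - cfc p R * E := by
    rw [cfc_sub p (fun x => p x * χ x) R hpc.continuousOn (hpc.mul hχc).continuousOn,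
      cfc_mul p χ R hpc.continuousOn hχc.continuousOn]
  obtain ⟨heD, heQ⟩ := generator_fixed he
  have hg : ⟪e, (μ : ℂ) • (f : H) - generator T f⟫_ℂ = 0 := by
    rw [inner_sub_right, inner_smul_right, hf, ← hT.generator_symm ⟨e, heD⟩ f, heQ]
    simp
  have h0 := ((ContinuousLinearMap.nonneg_iff_isPositive _).1 hnonneg).2
    ((μ : ℂ) • (f : H) - generator T f)
  rw [ContinuousLinearMap.reApplyInnerSelf_apply, hcfc, sub_apply,
    mul_apply_eq_comp, hE0 _ hg, map_zero, sub_zero, hpR,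
    sub_apply, smul_apply,
    mul_apply_eq_comp, hR2, inner_sub_left, ← Complex.coe_smul, inner_smul_left,
    hT.resolvent_symm hR, hR2, inner_sub_right, inner_smul_right, RCLike.re_to_complex,
    Complex.conj_ofReal, Complex.sub_re, Complex.sub_re, Complex.re_ofReal_mul,
    Complex.re_ofReal_mul] at h0
  have h2 : (⟪(f : H), (f : H)⟫_ℂ).re = ‖(f : H)‖ ^ 2 := inner_self_eq_norm_sq (𝕜 := ℂ) _
  rw [h2] at h0
  linarith

/-- The range of the symmetric operator `R = (μ - Q)⁻¹` is dense because `R` is injective. -/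
theorem dense_generator_domain (hT : IsSymmetricContractionSemigroup T) (hδ : 0 < δ)
    (hgap : ∀ z ∈ unboundedSpectrum (generator T), z ≠ 0 → δ ≤ ‖z‖) :
    Dense ((generator T).domain : Set H) := by
  obtain ⟨R, -, hR, -, -⟩ := hT.exists_resolvent hδ hgap
  rw [Submodule.dense_iff_topologicalClosure_eq_top, Submodule.topologicalClosure_eq_top_iff,
    Submodule.eq_bot_iff]
  intro g hg
  have h0 : R g = 0 := by
    obtain ⟨f, hf, -⟩ := hR (R g)
    have := hg f f.2
    rw [hf, hT.resolvent_symm hR] at this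
    exact inner_self_eq_zero.1 this
  obtain ⟨f, hf, hfg⟩ := hR g
  have hf0 : f = 0 := Subtype.ext (hf.trans h0)
  rw [← hfg, hf0]
  simp

/-- Exponential decay, at the rate given by the spectral gap, on the orthogonal complement of the
fixed vector `e`. -/
theorem norm_apply_le (hT : IsSymmetricContractionSemigroup T) (hδ : 0 < δ)
    (he : ∀ t, T t e = e) (he1 : ‖e‖ = 1)
    (hsimple : ∀ f : (generator T).domain, generator T f = 0 → ∃ c : ℂ, (f : H) = c • e)
    (hgap : ∀ z ∈ unboundedSpectrum (generator T), z ≠ 0 → δ ≤ ‖z‖)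
    {f : H} (hf : ⟪e, f⟫_ℂ = 0) (t : ℝ≥0) : ‖T t f‖ ≤ Real.exp (-δ * t) * ‖f‖ := by
  have hee : ⟪e, e⟫_ℂ = 1 := by rw [inner_self_eq_norm_sq_to_K, he1]; simp
  have heT : ∀ (s : ℝ≥0) (g : H), ⟪e, T s g⟫_ℂ = ⟪e, g⟫_ℂ := fun s g => by rw [← hT.symm, he]
  obtain ⟨heD, -⟩ := generator_fixed he
  -- The projected bound is closed in `g` and holds on the dense domain.
  have key : ∀ g : H, ‖T t (g - ⟪e, g⟫_ℂ • e)‖ ≤ Real.exp (-δ * t) * ‖g - ⟪e, g⟫_ℂ • e‖ := by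
    refine (hT.dense_generator_domain hδ hgap).induction (fun g hg => ?_) ?_
    · refine hT.norm_apply_le_of_dissipative
        ⟨g - ⟪e, g⟫_ℂ • e, Submodule.sub_mem _ hg (Submodule.smul_mem _ _ heD)⟩
        (fun s d hd => hT.re_inner_generator_le hδ he hsimple hgap d ?_) t
      rw [hd, heT, inner_sub_right, inner_smul_right, hee]
      simp
    · exact isClosed_le (by fun_prop) (by fun_prop)
  simpa [hf] using key f

end Gap

/-- Decay on the orthogonal complement of `e`, as a bound for the bilinear form of `T t`: split off
the components along `e` and apply the Cauchy-Schwarz inequality in the form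
`√(x² - a²) √(y² - b²) ≤ x y - a b`. -/
theorem norm_inner_apply_le (hT : IsSymmetricContractionSemigroup T) {e : H}
    (he : ∀ t, T t e = e) (he1 : ‖e‖ = 1) {c : ℝ} (hc : 0 ≤ c) {t : ℝ≥0}
    (hdecay : ∀ f, ⟪e, f⟫_ℂ = 0 → ‖T t f‖ ≤ c * ‖f‖) (u v : H) :
    ‖⟪u, T t v⟫_ℂ‖ ≤ ‖⟪e, u⟫_ℂ‖ * ‖⟪e, v⟫_ℂ‖ +
      c * (‖u‖ * ‖v‖ - ‖⟪e, u⟫_ℂ‖ * ‖⟪e, v⟫_ℂ‖) := by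
  have hee : ⟪e, e⟫_ℂ = 1 := by rw [inner_self_eq_norm_sq_to_K, he1]; simp
  have h0 : ∀ w : H, ⟪e, w - ⟪e, w⟫_ℂ • e⟫_ℂ = 0 := fun w => by
    rw [inner_sub_right, inner_smul_right, hee]; simp
  have hnorm : ∀ w : H, ‖w - ⟪e, w⟫_ℂ • e‖ ^ 2 = ‖w‖ ^ 2 - ‖⟪e, w⟫_ℂ‖ ^ 2 := fun w => by
    have h1 : ⟪w - ⟪e, w⟫_ℂ • e, ⟪e, w⟫_ℂ • e⟫_ℂ = 0 := by
      rw [inner_smul_right, inner_eq_zero_symm.1 (h0 w), mul_zero]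
    have h2 := norm_add_sq_eq_norm_sq_add_norm_sq_of_inner_eq_zero _ _ h1
    rw [sub_add_cancel, norm_smul, he1] at h2
    linarith
  have hsplit : ⟪u, T t v⟫_ℂ = ⟪u, e⟫_ℂ * ⟪e, v⟫_ℂ +
      ⟪u - ⟪e, u⟫_ℂ • e, T t (v - ⟪e, v⟫_ℂ • e)⟫_ℂ := by
    have h1 : ⟪e, T t (v - ⟪e, v⟫_ℂ • e)⟫_ℂ = 0 := by rw [← hT.symm, he, h0]
    rw [inner_sub_left, inner_smul_left, h1, map_sub, map_smul, he, inner_sub_right,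
      inner_smul_right]
    ring
  have hcs : ‖u - ⟪e, u⟫_ℂ • e‖ * ‖v - ⟪e, v⟫_ℂ • e‖ ≤
      ‖u‖ * ‖v‖ - ‖⟪e, u⟫_ℂ‖ * ‖⟪e, v⟫_ℂ‖ := by
    have hle : ∀ w : H, ‖⟪e, w⟫_ℂ‖ ≤ ‖w‖ := fun w => by
      simpa [he1] using norm_inner_le_norm (𝕜 := ℂ) e w
    have h1 : 0 ≤ ‖u‖ * ‖v‖ - ‖⟪e, u⟫_ℂ‖ * ‖⟪e, v⟫_ℂ‖ :=
      sub_nonneg.2 (mul_le_mul (hle u) (hle v) (norm_nonneg _) (norm_nonneg _))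
    refine (pow_le_pow_iff_left₀ (by positivity) h1 two_ne_zero).1 ?_
    rw [mul_pow, hnorm, hnorm]
    nlinarith [sq_nonneg (‖u‖ * ‖⟪e, v⟫_ℂ‖ - ‖v‖ * ‖⟪e, u⟫_ℂ‖)]
  rw [hsplit]
  refine (norm_add_le _ _).trans (add_le_add ?_ ?_)
  · rw [norm_mul, norm_inner_symm]
  · refine (norm_inner_le_norm _ _).trans ?_
    calc _ ≤ ‖u - ⟪e, u⟫_ℂ • e‖ * (c * ‖v - ⟪e, v⟫_ℂ • e‖) := by
          gcongr; exact hdecay _ (h0 v)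
      _ = c * (‖u - ⟪e, u⟫_ℂ • e‖ * ‖v - ⟪e, v⟫_ℂ • e‖) := by ring
      _ ≤ _ := by gcongr

end IsSymmetricContractionSemigroup

end SemigroupDecay

/-! ### The Markov operators on `L²(π)` -/

section MarkovOperators

open scoped InnerProductSpace ComplexConjugate

variable {S : Type*} [MeasurableSpace S] {π : Measure S}

theorem ae_ae_of_invariant {κ : Kernel S S} (h : κ.Invariant π) {p : S → Prop}
    (hp : ∀ᵐ x ∂π, p x) : ∀ᵐ x ∂π, ∀ᵐ y ∂(κ x), p y :=
  Measure.ae_ae_of_ae_comp (by rwa [show π.bind κ = π from h])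

variable [IsProbabilityMeasure π]

theorem markovOperator_coeFn {κ : Kernel S S} [IsMarkovKernel κ] (h : κ.Invariant π)
    (f : Lp ℂ 2 π) : markovOperator κ π h f =ᵐ[π] fun x => ∫ y, f y ∂(κ x) :=
  MemLp.coeFn_toLp (memLp_integral_kernel h (Lp.memLp f))

theorem norm_markovOperator_apply_le {κ : Kernel S S} [IsMarkovKernel κ] (h : κ.Invariant π)
    (f : Lp ℂ 2 π) : ‖markovOperator κ π h f‖ ≤ ‖f‖ := by
  have h1 : ‖markovOperator κ π h‖ ≤ 1 := LinearMap.mkContinuous_norm_le _ zero_le_one _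
  simpa using (markovOperator κ π h).le_of_opNorm_le h1 f

/-- Under a reversible kernel, the joint law of one step is symmetric. -/
theorem measurePreserving_swap_compProd {κ : Kernel S S} [IsMarkovKernel κ]
    (h : κ.IsReversible π) : MeasurePreserving Prod.swap (π ⊗ₘ κ) (π ⊗ₘ κ) := by
  refine ⟨measurable_swap, Measure.ext_prod fun {s t} hs ht => ?_⟩
  rw [Measure.map_apply measurable_swap (hs.prod ht), Set.preimage_swap_prod,
    Measure.compProd_apply_prod ht hs, Measure.compProd_apply_prod hs ht, h hs ht]

theorem measurePreserving_fst_compProd {κ : Kernel S S} [IsMarkovKernel κ] :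
    MeasurePreserving Prod.fst (π ⊗ₘ κ) π :=
  ⟨measurable_fst, Measure.fst_compProd π κ⟩

theorem measurePreserving_snd_compProd {κ : Kernel S S} [IsMarkovKernel κ]
    (h : κ.Invariant π) : MeasurePreserving Prod.snd (π ⊗ₘ κ) π :=
  ⟨measurable_snd, (Measure.snd_compProd π κ).trans h⟩

theorem inner_markovOperator {κ : Kernel S S} [IsMarkovKernel κ] (h : κ.Invariant π)
    (f g : Lp ℂ 2 π) :
    ⟪f, markovOperator κ π h g⟫_ℂ = ∫ z, conj (f z.1) * g z.2 ∂(π ⊗ₘ κ) := by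
  have hf : MemLp (fun z : S × S => conj (f z.1)) 2 (π ⊗ₘ κ) :=
    ((Lp.memLp f).comp_measurePreserving measurePreserving_fst_compProd).star
  have hg : MemLp (fun z : S × S => g z.2) 2 (π ⊗ₘ κ) :=
    (Lp.memLp g).comp_measurePreserving (measurePreserving_snd_compProd h)
  have hint : Integrable (fun z : S × S => conj (f z.1) * g z.2) (π ⊗ₘ κ) := hf.integrable_mul hg
  rw [Measure.integral_compProd hint, L2.inner_def]
  refine integral_congr_ae ?_
  filter_upwards [markovOperator_coeFn h g] with x hx
  rw [hx, integral_const_mul]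
  simp [mul_comm]

theorem markovOperator_symm {κ : Kernel S S} [IsMarkovKernel κ] (h : κ.IsReversible π)
    (f g : Lp ℂ 2 π) : ⟪markovOperator κ π h.invariant f, g⟫_ℂ =
      ⟪f, markovOperator κ π h.invariant g⟫_ℂ := by
  rw [← inner_conj_symm, inner_markovOperator, inner_markovOperator, ← integral_conj,
    ← (measurePreserving_swap_compProd h).integral_comp
      MeasurableEquiv.prodComm.measurableEmbedding]
  simp [mul_comm]

theorem markovOperator_comp {κ η ρ : Kernel S S} [IsMarkovKernel κ] [IsMarkovKernel η]
    [IsMarkovKernel ρ] (hκ : κ.Invariant π) (hη : η.Invariant π) (hρ : ρ.Invariant π)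
    (h : ρ = η ∘ₖ κ) (f : Lp ℂ 2 π) :
    markovOperator ρ π hρ f = markovOperator κ π hκ (markovOperator η π hη f) := by
  refine Lp.ext ?_
  filter_upwards [markovOperator_coeFn hρ f, markovOperator_coeFn hκ (markovOperator η π hη f),
    ae_memLp_of_invariant hρ (Lp.memLp f),
    ae_ae_of_invariant hκ (markovOperator_coeFn hη f)] with x h1 h2 h3 h4
  have h5 : Integrable f ((η ∘ₖ κ) x) := by rw [← h]; exact h3.integrable (by norm_num)
  rw [h1, h2, integral_congr_ae h4, ← Kernel.integral_comp h5, h]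

variable (π) in
/-- The constant function `1` as a unit vector of `L²(π)`. -/
noncomputable def constOne : Lp ℂ 2 π := (memLp_const (1 : ℂ)).toLp (fun _ => 1)

theorem constOne_coeFn : constOne π =ᵐ[π] fun _ => (1 : ℂ) := MemLp.coeFn_toLp _

theorem norm_constOne : ‖constOne π‖ = 1 := by
  rw [constOne, Lp.norm_toLp, eLpNorm_const _ (by norm_num) (NeZero.ne π)]
  simp

theorem markovOperator_constOne {κ : Kernel S S} [IsMarkovKernel κ] (h : κ.Invariant π) :
    markovOperator κ π h (constOne π) = constOne π := by
  refine Lp.ext ?_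
  filter_upwards [markovOperator_coeFn h (constOne π), constOne_coeFn,
    ae_ae_of_invariant h constOne_coeFn] with x h1 h2 h3
  rw [h1, h2, integral_congr_ae h3]
  simp

theorem MarkovSemigroup.isSymmetricContractionSemigroup (K : MarkovSemigroup S)
    (hrev : K.IsReversible π) (hcont : StronglyContinuousAtZero (K.operator π hrev)) :
    IsSymmetricContractionSemigroup (K.operator π hrev) where
  zero f := by
    refine Lp.ext ?_
    filter_upwards [markovOperator_coeFn (hrev 0).invariant f] with x h1
    have h2 : K.kernel 0 x = Measure.dirac x := by rw [K.zero, Kernel.id_apply]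
    rw [MarkovSemigroup.operator, h1, h2, integral_dirac' _ _ (Lp.stronglyMeasurable f)]
  add s t f := markovOperator_comp _ _ _ (K.add s t) f
  norm_le t f := norm_markovOperator_apply_le _ f
  symm t f g := markovOperator_symm (hrev t) f g
  cont := hcont

/-- The `L²(μ)` norm of a `[0, ∞]`-valued function, as a real number (`0` if it is infinite). -/
noncomputable def lintegralNorm {α : Type*} [MeasurableSpace α] (μ : Measure α) (g : α → ℝ≥0∞) :
    ℝ :=
  √(∫⁻ x, g x ^ 2 ∂μ).toReal

theorem lintegralNorm_nonneg {α : Type*} [MeasurableSpace α] (μ : Measure α) (g : α → ℝ≥0∞) :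
    0 ≤ lintegralNorm μ g := Real.sqrt_nonneg _

theorem memLp_toReal {α : Type*} [MeasurableSpace α] {μ : Measure α} [IsFiniteMeasure μ]
    {u : α → ℝ≥0∞} (hu : Measurable u) {C : ℝ≥0} (hC : ∀ x, u x ≤ C) :
    MemLp (fun x => ((u x).toReal : ℂ)) 2 μ := by
  refine MemLp.of_bound
    (Complex.measurable_ofReal.comp hu.ennreal_toReal).aestronglyMeasurable C
    (Eventually.of_forall fun x => ?_)
  rw [Complex.norm_real, Real.norm_of_nonneg ENNReal.toReal_nonneg]
  exact ENNReal.toReal_le_of_le_ofReal C.coe_nonneg (by simpa using hC x)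

theorem norm_toLp_toReal {α : Type*} [MeasurableSpace α] {μ : Measure α} [IsFiniteMeasure μ]
    {u : α → ℝ≥0∞} (hu : Measurable u) {C : ℝ≥0} (hC : ∀ x, u x ≤ C) :
    ‖(memLp_toReal (μ := μ) hu hC).toLp _‖ = lintegralNorm μ u := by
  rw [Lp.norm_toLp, lintegralNorm, eLpNorm_eq_lintegral_rpow_enorm_toReal (by simp) (by simp),
    Real.sqrt_eq_rpow, ENNReal.toReal_rpow]
  congr 2
  · refine lintegral_congr fun x => ?_
    have h1 : ‖((u x).toReal : ℂ)‖ₑ = u x := by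
      rw [← ofReal_norm, Complex.norm_real, Real.norm_of_nonneg ENNReal.toReal_nonneg,
        ENNReal.ofReal_toReal ((hC x).trans_lt ENNReal.coe_lt_top).ne]
    rw [h1]; simp

theorem inner_constOne_toReal {u : S → ℝ≥0∞} (hu : Measurable u) {C : ℝ≥0} (hC : ∀ x, u x ≤ C) :
    ⟪constOne π, (memLp_toReal (μ := π) hu hC).toLp _⟫_ℂ = ((∫⁻ x, u x ∂π).toReal : ℂ) := by
  rw [L2.inner_def, ← integral_toReal hu.aemeasurable
    (Eventually.of_forall fun x => (hC x).trans_lt ENNReal.coe_lt_top), ← integral_complex_ofReal]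
  refine integral_congr_ae ?_
  filter_upwards [constOne_coeFn (π := π), (memLp_toReal (μ := π) hu hC).coeFn_toLp] with x h1 h2
  rw [h1, h2]
  simp

theorem lintegral_kernel_le_of_le {κ : Kernel S S} [IsMarkovKernel κ] {v : S → ℝ≥0∞} {C : ℝ≥0}
    (hv : ∀ x, v x ≤ C) (x : S) : ∫⁻ y, v y ∂κ x ≤ C :=
  (lintegral_mono hv).trans (by simp)

theorem inner_markovOperator_toReal {κ : Kernel S S} [IsMarkovKernel κ] (h : κ.Invariant π)
    {u v : S → ℝ≥0∞} (hu : Measurable u) (hv : Measurable v) {C D : ℝ≥0} (hC : ∀ x, u x ≤ C)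
    (hD : ∀ x, v x ≤ D) :
    ⟪(memLp_toReal (μ := π) hu hC).toLp _,
      markovOperator κ π h ((memLp_toReal (μ := π) hv hD).toLp _)⟫_ℂ =
        ((∫⁻ x, u x * ∫⁻ y, v y ∂κ x ∂π).toReal : ℂ) := by
  have hlt : ∀ x, v x < ∞ := fun x => (hD x).trans_lt ENNReal.coe_lt_top
  rw [L2.inner_def, ← integral_toReal (f := fun x => u x * ∫⁻ y, v y ∂κ x)
    (hu.mul hv.lintegral_kernel).aemeasurable
    (Eventually.of_forall fun x => ENNReal.mul_lt_top ((hC x).trans_lt ENNReal.coe_lt_top)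
      ((lintegral_kernel_le_of_le hD x).trans_lt ENNReal.coe_lt_top)), ← integral_complex_ofReal]
  refine integral_congr_ae ?_
  filter_upwards [(memLp_toReal (μ := π) hu hC).coeFn_toLp, markovOperator_coeFn h _,
    ae_ae_of_invariant h (memLp_toReal (μ := π) hv hD).coeFn_toLp] with x h1 h2 h3
  rw [h1, h2, integral_congr_ae h3, integral_complex_ofReal,
    integral_toReal hv.aemeasurable (Eventually.of_forall hlt)]
  simp [mul_comm]

/-- The correlation inequality for two times of a reversible Markov semigroup with a spectral
gap. -/
theorem lintegral_mul_lintegral_kernel_le (K : MarkovSemigroup S) (hrev : K.IsReversible π)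
    (hcont : StronglyContinuousAtZero (K.operator π hrev)) {δ : ℝ} (hδ : 0 < δ)
    (hgap : HasSpectralGap (generator (K.operator π hrev)) δ) (t : ℝ≥0) {u v : S → ℝ≥0∞}
    (hu : Measurable u) (hv : Measurable v) {C D : ℝ≥0} (hC : ∀ x, u x ≤ C)
    (hD : ∀ x, v x ≤ D) :
    (∫⁻ x, u x * ∫⁻ y, v y ∂(K.kernel t x) ∂π).toReal ≤
      (∫⁻ x, u x ∂π).toReal * (∫⁻ x, v x ∂π).toReal + Real.exp (-δ * t) *
        (lintegralNorm π u * lintegralNorm π v -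
          (∫⁻ x, u x ∂π).toReal * (∫⁻ x, v x ∂π).toReal) := by
  have hT := K.isSymmetricContractionSemigroup hrev hcont
  have he : ∀ t, K.operator π hrev t (constOne π) = constOne π := fun t =>
    markovOperator_constOne _
  have hsimple : ∀ f : (generator (K.operator π hrev)).domain,
      generator (K.operator π hrev) f = 0 → ∃ c : ℂ, (f : Lp ℂ 2 π) = c • constOne π := by
    intro f hf
    obtain ⟨c, hc⟩ := hgap.simple f hf
    refine ⟨c, Lp.ext ?_⟩
    filter_upwards [hc, Lp.coeFn_smul c (constOne π), constOne_coeFn (π := π)] with x h1 h2 h3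
    rw [h1, h2, Pi.smul_apply, h3]
    simp
  have key := hT.norm_inner_apply_le he norm_constOne (Real.exp_pos (-δ * t)).le (t := t)
    (fun f hf => hT.norm_apply_le hδ he norm_constOne hsimple hgap.gap hf t)
    ((memLp_toReal (μ := π) hu hC).toLp _) ((memLp_toReal (μ := π) hv hD).toLp _)
  rw [MarkovSemigroup.operator, inner_markovOperator_toReal _ hu hv hC hD,
    inner_constOne_toReal hu hC, inner_constOne_toReal hv hD, norm_toLp_toReal hu hC,
    norm_toLp_toReal hv hD] at key
  simpa only [Complex.norm_real, Real.norm_of_nonneg ENNReal.toReal_nonneg] using key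

end MarkovOperators

/-! ### Weighted integrals and the sigma-algebras of the path -/

section WeightedIntegrals

variable {α : Type*} {m m0 : MeasurableSpace α} {μ : Measure α}

theorem lintegral_mul_eq_of_trim_withDensity_eq (hm : m ≤ m0) {f g : α → ℝ≥0∞}
    (hf : Measurable f) (hg : Measurable g)
    (h : (μ.withDensity f).trim hm = (μ.withDensity g).trim hm) {Y : α → ℝ≥0∞}
    (hY : Measurable[m] Y) : ∫⁻ x, f x * Y x ∂μ = ∫⁻ x, g x * Y x ∂μ := by
  have hY' : Measurable Y := hY.mono hm le_rfl
  have key : ∀ {f : α → ℝ≥0∞}, Measurable f →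
      ∫⁻ x, f x * Y x ∂μ = ∫⁻ x, Y x ∂((μ.withDensity f).trim hm) := fun hf => by
    rw [lintegral_trim hm hY, lintegral_withDensity_eq_lintegral_mul _ hf hY']
    rfl
  rw [key hf, key hg, h]

theorem lintegral_sq_lt_top [IsFiniteMeasure μ] {g : α → ℝ≥0∞} {C : ℝ≥0} (hC : ∀ x, g x ≤ C) :
    ∫⁻ x, g x ^ 2 ∂μ < ∞ := by
  refine (lintegral_mono fun x => pow_le_pow_left' (hC x) 2).trans_lt ?_
  rw [lintegral_const]
  exact ENNReal.mul_lt_top (by simp) (measure_lt_top μ _)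

theorem lintegralNorm_sq (g : α → ℝ≥0∞) :
    lintegralNorm μ g ^ 2 = (∫⁻ x, g x * g x ∂μ).toReal := by
  rw [lintegralNorm, Real.sq_sqrt ENNReal.toReal_nonneg]
  simp_rw [sq]

theorem lintegral_mul_le_lintegralNorm [IsFiniteMeasure μ] {g h : α → ℝ≥0∞} (hg : Measurable g)
    (hh : Measurable h) {C D : ℝ≥0} (hC : ∀ x, g x ≤ C) (hD : ∀ x, h x ≤ D) :
    (∫⁻ x, g x * h x ∂μ).toReal ≤ lintegralNorm μ g * lintegralNorm μ h := by
  have h1 := ENNReal.lintegral_mul_le_Lp_mul_Lq μ Real.HolderConjugate.two_two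
    hg.aemeasurable hh.aemeasurable
  simp only [Pi.mul_apply, ENNReal.rpow_ofNat] at h1
  have h2 := ENNReal.toReal_mono (ENNReal.mul_ne_top
    (ENNReal.rpow_ne_top_of_nonneg (by norm_num) (lintegral_sq_lt_top hC).ne)
    (ENNReal.rpow_ne_top_of_nonneg (by norm_num) (lintegral_sq_lt_top hD).ne)) h1
  rwa [ENNReal.toReal_mul, ← ENNReal.toReal_rpow, ← ENNReal.toReal_rpow, ← Real.sqrt_eq_rpow,
    ← Real.sqrt_eq_rpow] at h2

theorem lintegralNorm_indicator_one {A : Set α} (hA : MeasurableSet A) :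
    lintegralNorm μ (A.indicator 1) = √(μ.real A) := by
  have : (fun x => A.indicator (1 : α → ℝ≥0∞) x ^ 2) = A.indicator 1 := by
    ext x; by_cases hx : x ∈ A <;> simp [hx]
  rw [lintegralNorm, this, lintegral_indicator_one hA]
  rfl

theorem measurable_indicator_one {α : Type*} {m : MeasurableSpace α} {A : Set α}
    (hA : MeasurableSet A) : Measurable (A.indicator (1 : α → ℝ≥0∞)) :=
  measurable_one.indicator hA

theorem measurable_mul_indicator_one {α : Type*} {m : MeasurableSpace α} {g : α → ℝ≥0∞}
    (hg : Measurable g) {A : Set α} (hA : MeasurableSet A) :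
    Measurable fun x => g x * A.indicator 1 x :=
  hg.mul (measurable_indicator_one hA)

theorem indicator_one_le (A : Set α) (x : α) : A.indicator (1 : α → ℝ≥0∞) x ≤ (1 : ℝ≥0) := by
  by_cases hx : x ∈ A <;> simp [hx]

/-- A function that vanishes outside `A` has a mean of at most `√(μ A)` times its norm. -/
theorem lintegral_mul_indicator_le [IsFiniteMeasure μ] {g : α → ℝ≥0∞} (hg : Measurable g)
    {C : ℝ≥0} (hC : ∀ x, g x ≤ C) {A : Set α} (hA : MeasurableSet A) :
    (∫⁻ x, g x * A.indicator 1 x ∂μ).toReal ≤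
      lintegralNorm μ (fun x => g x * A.indicator 1 x) * √(μ.real A) := by
  have h1 : ∀ x, g x * A.indicator 1 x = g x * A.indicator 1 x * A.indicator 1 x := fun x => by
    by_cases hx : x ∈ A <;> simp [hx]
  rw [← lintegralNorm_indicator_one hA, lintegral_congr h1]
  refine lintegral_mul_le_lintegralNorm (C := C) (D := 1)
    (measurable_mul_indicator_one hg hA) (measurable_one.indicator hA) (fun x => ?_)
    (indicator_one_le A)
  exact (mul_le_mul' (hC x) (indicator_one_le A x)).trans (by simp)

end WeightedIntegrals

section PathSigma

variable {S Ω : Type*} [MeasurableSpace S]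

theorem measurable_pathSigma (X : ℝ → Ω → S) {I : Set ℝ} {t : ℝ} (ht : t ∈ I) :
    Measurable[pathSigma X I] (X t) := by
  intro B hB
  exact le_iSup₂ (f := fun t (_ : t ∈ I) => MeasurableSpace.comap (X t) inferInstance) t ht _
    ⟨B, hB, rfl⟩

theorem pathSigma_mono (X : ℝ → Ω → S) {I J : Set ℝ} (h : I ⊆ J) :
    pathSigma X I ≤ pathSigma X J :=
  biSup_mono h

theorem pathSigma_le [MeasurableSpace Ω] {X : ℝ → Ω → S} (hX : ∀ t, Measurable (X t))
    (I : Set ℝ) : pathSigma X I ≤ ‹MeasurableSpace Ω› :=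
  iSup₂_le fun t _ => (hX t).comap_le

theorem measurableSet_pathSigma_shift (X : ℝ → Ω → S) (s : ℝ) {a b : ℝ} {A : Set (ℝ → S)}
    (hA : MeasurableSet[pathSigma (fun t (x : ℝ → S) => x t) (Set.Icc a b)] A) :
    MeasurableSet[pathSigma X (Set.Icc (a + s) (b + s))] {ω | (fun u => X (u + s) ω) ∈ A} := by
  have hle : pathSigma (fun t (x : ℝ → S) => x t) (Set.Icc a b) ≤
      (pathSigma X (Set.Icc (a + s) (b + s))).map fun ω u => X (u + s) ω := by
    refine iSup₂_le fun t ht => ?_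
    rintro _ ⟨B, hB, rfl⟩
    exact measurable_pathSigma X
      (⟨by linarith [ht.1], by linarith [ht.2]⟩ : t + s ∈ Set.Icc (a + s) (b + s)) hB
  exact hle A hA

end PathSigma

/-! ### Markov property and stationarity of the path -/

namespace IsStationaryMarkov

variable {S Ω : Type*} [MeasurableSpace S] [MeasurableSpace Ω] {π : Measure S}
  {K : MarkovSemigroup S} {P : Measure Ω} {X : ℝ → Ω → S}

theorem lintegral_comp (hX : IsStationaryMarkov K π X P) (s : ℝ) {u : S → ℝ≥0∞}
    (hu : Measurable u) : ∫⁻ ω, u (X s ω) ∂P = ∫⁻ x, u x ∂π := by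
  rw [← hX.law s, lintegral_map hu (hX.measurable s)]

variable [IsProbabilityMeasure P]

theorem measure_inter_preimage (hX : IsStationaryMarkov K π X P) (s : ℝ) (t : ℝ≥0) {E : Set Ω}
    (hE : MeasurableSet[pathSigma X (Set.Iic s)] E) {B : Set S} (hB : MeasurableSet B) :
    P (X (s + t) ⁻¹' B ∩ E) = ∫⁻ ω in E, K.kernel t (X s ω) B ∂P := by
  have hm := pathSigma_le hX.measurable (Set.Iic s)
  have hB' : MeasurableSet (X (s + t) ⁻¹' B) := hX.measurable _ hB
  have hmeas : Measurable fun ω => K.kernel t (X s ω) B :=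
    ((K.kernel t).measurable_coe hB).comp (hX.measurable s)
  have h1 := setIntegral_condExp hm (μ := P) (s := E)
    (f := (X (s + t) ⁻¹' B).indicator fun _ => (1 : ℝ))
    ((integrable_const 1).indicator hB') hE
  rw [setIntegral_congr_ae (g := fun ω => (K.kernel t (X s ω)).real B) (hm _ hE)
    (by filter_upwards [hX.markov s t B hB] with ω hω _ using hω)] at h1
  simp only [Measure.real] at h1
  rw [integral_toReal hmeas.aemeasurable (Eventually.of_forall fun ω => measure_lt_top _ _),
    integral_indicator_const _ hB', smul_eq_mul, mul_one, Measure.real,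
    Measure.restrict_apply hB'] at h1
  refine ((ENNReal.toReal_eq_toReal_iff' ?_ (measure_ne_top _ _)).1 h1).symm
  refine ((lintegral_mono fun ω => prob_le_one).trans_lt ?_).ne
  simp [measure_lt_top]

/-- The Markov property, integrated against a weight that depends on the past. -/
theorem lintegral_mul_comp_add (hX : IsStationaryMarkov K π X P) (s : ℝ) (t : ℝ≥0)
    {u : S → ℝ≥0∞} (hu : Measurable u) {Y : Ω → ℝ≥0∞}
    (hY : Measurable[pathSigma X (Set.Iic s)] Y) :
    ∫⁻ ω, Y ω * u (X (s + t) ω) ∂P = ∫⁻ ω, Y ω * ∫⁻ y, u y ∂K.kernel t (X s ω) ∂P := by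
  have hm := pathSigma_le hX.measurable (Set.Iic s)
  have hf : Measurable fun ω => u (X (s + t) ω) := hu.comp (hX.measurable _)
  have hg : Measurable fun ω => ∫⁻ y, u y ∂K.kernel t (X s ω) :=
    hu.lintegral_kernel.comp (hX.measurable s)
  simp_rw [mul_comm (Y _)]
  refine lintegral_mul_eq_of_trim_withDensity_eq hm hf hg ?_ hY
  refine @Measure.ext _ (pathSigma X (Set.Iic s)) _ _ fun E hE => ?_
  rw [trim_measurableSet_eq hm hE, trim_measurableSet_eq hm hE, withDensity_apply _ (hm _ hE),
    withDensity_apply _ (hm _ hE)]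
  -- On an event `E` of the past, the law of `X (s + t)` is that of `X s` moved by the kernel.
  have hlaw : (P.restrict E).map (X (s + t)) = ((P.restrict E).map (X s)).bind (K.kernel t) := by
    ext B hB
    rw [Measure.map_apply (hX.measurable _) hB, Measure.restrict_apply (hX.measurable _ hB),
      hX.measure_inter_preimage s t hE hB, Measure.bind_apply hB (Kernel.aemeasurable _),
      lintegral_map ((K.kernel t).measurable_coe hB) (hX.measurable s)]
  rw [← lintegral_map hu (hX.measurable _), hlaw,
    Measure.lintegral_bind (Kernel.aemeasurable _) hu.aemeasurable,
    lintegral_map hu.lintegral_kernel (hX.measurable s)]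

/-- The conditional probability of a cylinder event after time `s`, given the past, is a function
of the position at time `s`, and this function does not change when all times are shifted. -/
theorem exists_lintegral_mul_cylinder (hX : IsStationaryMarkov K π X P) (B : ℝ → Set S)
    (F : Finset ℝ) : (∀ t ∈ F, MeasurableSet (B t)) → ∀ s, (∀ t ∈ F, s ≤ t) →
    ∃ φ : S → ℝ≥0∞, Measurable φ ∧ ∀ r, ∀ Y : Ω → ℝ≥0∞,
      Measurable[pathSigma X (Set.Iic (s + r))] Y →
      ∫⁻ ω, Y ω * (⋂ t ∈ F, X (t + r) ⁻¹' B t).indicator 1 ω ∂P =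
        ∫⁻ ω, Y ω * φ (X (s + r) ω) ∂P := by
  induction F using Finset.induction_on_min with
  | empty => exact fun _ s _ => ⟨fun _ => 1, measurable_const, fun r Y _ => by simp⟩
  | insert a F haF ih =>
    intro hB s hs
    obtain ⟨φ, hφ, hφF⟩ := ih (fun t ht => hB t (Finset.mem_insert_of_mem ht)) a
      fun t ht => (haF t ht).le
    have hBa := hB a (Finset.mem_insert_self a F)
    have hsa := hs a (Finset.mem_insert_self a F)
    have hu : Measurable fun x => (B a).indicator (1 : S → ℝ≥0∞) x * φ x :=
      (measurable_one.indicator hBa).mul hφ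
    refine ⟨fun x => ∫⁻ y, (B a).indicator 1 y * φ y ∂K.kernel (a - s).toNNReal x,
      hu.lintegral_kernel, fun r Y hY => ?_⟩
    have hY' : Measurable[pathSigma X (Set.Iic (a + r))]
        fun ω => Y ω * (B a).indicator 1 (X (a + r) ω) :=
      (hY.mono (pathSigma_mono X (Set.Iic_subset_Iic.2 (by linarith))) le_rfl).mul
        ((measurable_one.indicator hBa).comp (measurable_pathSigma X Set.self_mem_Iic))
    have h1 := hX.lintegral_mul_comp_add (s + r) (a - s).toNNReal hu hY
    rw [Real.coe_toNNReal _ (by linarith), show s + r + (a - s) = a + r by ring] at h1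
    rw [← h1]
    simp_rw [← mul_assoc]
    rw [← hφF r _ hY']
    refine lintegral_congr fun ω => ?_
    rw [mul_assoc]
    congr 1
    rw [Finset.set_biInter_insert, Set.inter_indicator_one]
    rfl

/-- The conditional expectation of a bounded function given `X s`, as a function on `S`. -/
theorem exists_condExp_factor (hX : IsStationaryMarkov K π X P) (s : ℝ)
    {w : Ω → ℝ≥0∞} (hw : Measurable w) {C : ℝ≥0} (hC : ∀ ω, w ω ≤ C) :
    ∃ ψ : S → ℝ≥0∞, Measurable ψ ∧ (∀ x, ψ x ≤ C) ∧
      (∀ u : S → ℝ≥0∞, Measurable u → ∫⁻ ω, w ω * u (X s ω) ∂P = ∫⁻ x, ψ x * u x ∂π) ∧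
      lintegralNorm π ψ ≤ lintegralNorm P w := by
  have hXs := hX.measurable s
  have hπ : IsProbabilityMeasure π := hX.law s ▸ Measure.isProbabilityMeasure_map hXs.aemeasurable
  have hwfin : IsFiniteMeasure (P.withDensity w) := isFiniteMeasure_withDensity
    (((lintegral_mono hC).trans_lt (by simp)).ne)
  set ν := (P.withDensity w).map (X s) with hν
  have hle : ∀ A, MeasurableSet A → ν A ≤ C * π A := by
    intro A hA
    rw [hν, Measure.map_apply hXs hA, withDensity_apply _ (hXs hA), ← hX.law s,
      Measure.map_apply hXs hA]
    exact (lintegral_mono hC).trans (by simp)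
  have hac : ν ≪ π := Measure.AbsolutelyContinuous.mk fun A hA h0 => by
    have := hle A hA
    rwa [h0, mul_zero, nonpos_iff_eq_zero] at this
  have hrn : ∀ᵐ x ∂π, ν.rnDeriv π x ≤ C := by
    refine ae_le_of_forall_setLIntegral_le_of_sigmaFinite (Measure.measurable_rnDeriv _ _)
      fun A hA _ => ?_
    rw [Measure.setLIntegral_rnDeriv hac]
    simpa using hle A hA
  -- The truncation changes the density on a null set only and makes the bound hold everywhere.
  have hψ : Measurable fun x => min (ν.rnDeriv π x) C :=
    (Measure.measurable_rnDeriv _ _).min measurable_const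
  have hψu : ∀ u : S → ℝ≥0∞, Measurable u →
      ∫⁻ ω, w ω * u (X s ω) ∂P = ∫⁻ x, min (ν.rnDeriv π x) C * u x ∂π := by
    intro u hu
    have h1 : ∫⁻ ω, w ω * u (X s ω) ∂P = ∫⁻ x, u x ∂ν := by
      rw [hν, lintegral_map hu hXs,
        lintegral_withDensity_eq_lintegral_mul _ hw (g := fun ω => u (X s ω)) (hu.comp hXs)]
      rfl
    rw [h1, ← lintegral_rnDeriv_mul hac hu.aemeasurable]
    refine lintegral_congr_ae ?_
    filter_upwards [hrn] with x hx
    rw [min_eq_left hx]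
  have hψC : ∀ x, min (ν.rnDeriv π x) C ≤ C := fun x => min_le_right _ _
  refine ⟨_, hψ, hψC, hψu, ?_⟩
  set ψ : S → ℝ≥0∞ := fun x => min (ν.rnDeriv π x) C
  have h1 := lintegral_mul_le_lintegralNorm (μ := P) hw (hψ.comp hXs) hC fun ω => hψC (X s ω)
  have h2 : lintegralNorm P (ψ ∘ X s) = lintegralNorm π ψ := by
    rw [lintegralNorm, lintegralNorm, ← hX.lintegral_comp s (hψ.pow_const 2)]
    rfl
  rw [h2] at h1
  simp only [Function.comp_apply] at h1
  rw [hψu ψ hψ, ← lintegralNorm_sq, sq] at h1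
  rcases (lintegralNorm_nonneg π ψ).eq_or_lt with h0 | h0
  · rw [← h0]; exact lintegralNorm_nonneg _ _
  · exact le_of_mul_le_mul_right h1 h0

/-- The conditional expectation, given the future, of a function of the past depends on the
present only. -/
theorem exists_condExp_future (hX : IsStationaryMarkov K π X P) (s : ℝ) {g : Ω → ℝ≥0∞}
    (hg : Measurable[pathSigma X (Set.Iic s)] g) {C : ℝ≥0} (hC : ∀ ω, g ω ≤ C) :
    ∃ ψ : S → ℝ≥0∞, Measurable ψ ∧ (∀ x, ψ x ≤ C) ∧
      ∀ h : Ω → ℝ≥0∞, Measurable[pathSigma X (Set.Ici s)] h →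
        ∫⁻ ω, g ω * h ω ∂P = ∫⁻ ω, ψ (X s ω) * h ω ∂P := by
  have hg' : Measurable g := hg.mono (pathSigma_le hX.measurable _) le_rfl
  obtain ⟨ψ, hψ, hψC, hψu, -⟩ := hX.exists_condExp_factor s hg' hC
  -- Both sides integrate `h` against finite measures, which are compared on cylinder events.
  refine ⟨ψ, hψ, hψC, fun h hh => ?_⟩
  have hm := pathSigma_le hX.measurable (Set.Ici s)
  have hψX : Measurable fun ω => ψ (X s ω) := hψ.comp (hX.measurable s)
  have hgfin : IsFiniteMeasure (P.withDensity g) := isFiniteMeasure_withDensity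
    (((lintegral_mono hC).trans_lt (by simp)).ne)
  refine lintegral_mul_eq_of_trim_withDensity_eq hm hg' hψX ?_ hh
  have hset : ∀ f : Ω → ℝ≥0∞, ∀ E, MeasurableSet[pathSigma X (Set.Ici s)] E →
      (P.withDensity f).trim hm E = ∫⁻ ω, f ω * E.indicator 1 ω ∂P := by
    intro f E hE
    rw [trim_measurableSet_eq hm hE, withDensity_apply _ (hm _ hE),
      ← lintegral_indicator (hm _ hE)]
    refine lintegral_congr fun ω => ?_
    by_cases hω : ω ∈ E <;> simp [hω]
  -- Cylinder events form a π-system that generates the future.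
  have hgen := generateFrom_piiUnionInter_measurableSet
    (fun t => MeasurableSpace.comap (X t) inferInstance) (Set.Ici s)
  have hpi := isPiSystem_piiUnionInter
    (fun t => {A | MeasurableSet[MeasurableSpace.comap (X t) inferInstance] A})
    (fun t => @MeasurableSpace.isPiSystem_measurableSet _
      (MeasurableSpace.comap (X t) inferInstance)) (Set.Ici s)
  refine @ext_of_generate_finite _ (pathSigma X (Set.Ici s)) _ _ _ hgen.symm hpi
    (isFiniteMeasure_trim hm) (fun E hE => ?_) ?_
  · have hEm : MeasurableSet[pathSigma X (Set.Ici s)] E := by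
      have := MeasurableSpace.measurableSet_generateFrom hE
      rwa [hgen] at this
    rw [hset _ E hEm, hset _ E hEm]
    obtain ⟨F, hF, A, hA, rfl⟩ := hE
    choose! B hB hBA using hA
    obtain ⟨φ, hφ, hφF⟩ := hX.exists_lintegral_mul_cylinder B F hB s fun t ht => hF ht
    have hEq : (⋂ t ∈ F, A t) = ⋂ t ∈ F, X (t + 0) ⁻¹' B t := by
      refine Set.iInter₂_congr fun t ht => ?_
      rw [add_zero, hBA t ht]
    have h1 : ∀ Y : Ω → ℝ≥0∞, Measurable[pathSigma X (Set.Iic s)] Y →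
        ∫⁻ ω, Y ω * (⋂ t ∈ F, A t).indicator 1 ω ∂P = ∫⁻ ω, Y ω * φ (X s ω) ∂P := fun Y hY => by
      rw [hEq]
      simpa only [add_zero] using hφF 0 Y (by rwa [add_zero])
    rw [h1 g hg, h1 (fun ω => ψ (X s ω)) (hψ.comp (measurable_pathSigma X Set.self_mem_Iic)),
      hψu φ hφ, ← hX.lintegral_comp s (u := fun x => ψ x * φ x) (hψ.mul hφ)]
  · rw [hset _ _ MeasurableSet.univ, hset _ _ MeasurableSet.univ]
    simpa [hX.lintegral_comp s hψ] using hψu (fun _ => 1) measurable_const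

/-- The law of the process is invariant under time shifts. -/
theorem map_shift (hX : IsStationaryMarkov K π X P) (r : ℝ) :
    P.map (fun ω t => X (t + r) ω) = P.map (fun ω t => X t ω) := by
  have hmeas : ∀ r, Measurable fun ω t => X (t + r) ω := fun r =>
    measurable_pi_lambda _ fun t => hX.measurable _
  have hmeas0 : Measurable fun ω t => X t ω := measurable_pi_lambda _ fun t => hX.measurable _
  have hgen := generateFrom_piiUnionInter_measurableSet
    (fun t => MeasurableSpace.comap (fun x : ℝ → S => x t) inferInstance) Set.univ
  simp only [Set.mem_univ, iSup_pos] at hgen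
  have hpi := isPiSystem_piiUnionInter
    (fun t => {A | MeasurableSet[MeasurableSpace.comap (fun x : ℝ → S => x t) inferInstance] A})
    (fun t => @MeasurableSpace.isPiSystem_measurableSet _
      (MeasurableSpace.comap (fun x : ℝ → S => x t) inferInstance)) Set.univ
  have hfin : IsProbabilityMeasure (P.map (fun ω t => X (t + r) ω)) :=
    Measure.isProbabilityMeasure_map (hmeas r).aemeasurable
  refine ext_of_generate_finite _ hgen.symm hpi (fun E hE => ?_) ?_
  · have hEm : MeasurableSet E := by
      have := MeasurableSpace.measurableSet_generateFrom hE
      rwa [hgen] at this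
    rw [Measure.map_apply (hmeas r) hEm, Measure.map_apply hmeas0 hEm]
    obtain ⟨F, -, A, hA, rfl⟩ := hE
    choose! B hB hBA using hA
    obtain ⟨s, hs⟩ := F.bddBelow
    obtain ⟨φ, hφ, hφF⟩ := hX.exists_lintegral_mul_cylinder B F hB s fun t ht => hs ht
    have hcyl : ∀ r, P (⋂ t ∈ F, X (t + r) ⁻¹' B t) = ∫⁻ x, φ x ∂π := by
      intro r
      have h1 := hφF r (fun _ => 1) measurable_const
      simp only [one_mul] at h1
      rw [hX.lintegral_comp _ hφ, lintegral_indicator_one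
        (Finset.measurableSet_biInter _ fun t ht => hX.measurable _ (hB t ht))] at h1
      exact h1
    have hpre : ∀ r, (fun ω t => X (t + r) ω) ⁻¹' (⋂ t ∈ F, A t) =
        ⋂ t ∈ F, X (t + r) ⁻¹' B t := by
      intro r
      rw [Set.preimage_iInter₂]
      refine Set.iInter₂_congr fun t ht => ?_
      rw [← hBA t ht]
      rfl
    have hpre0 := hpre 0
    simp only [add_zero] at hpre0
    have hcyl0 := hcyl 0
    simp only [add_zero] at hcyl0
    rw [hpre, hcyl, hpre0, hcyl0]
  · rw [Measure.map_apply (hmeas r) MeasurableSet.univ, Measure.map_apply hmeas0 MeasurableSet.univ]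
    rfl

theorem measure_shift (hX : IsStationaryMarkov K π X P) (s : ℝ) {a b : ℝ} {A : Set (ℝ → S)}
    (hA : MeasurableSet[pathSigma (fun t (x : ℝ → S) => x t) (Set.Icc a b)] A) :
    P.real {ω | (fun u => X (u + s) ω) ∈ A} = P.real {ω | (fun u => X u ω) ∈ A} := by
  have hA' : MeasurableSet A := pathSigma_le (fun t => measurable_pi_apply t) _ _ hA
  have h1 : (P.map fun ω t => X (t + s) ω).real A = (P.map fun ω t => X t ω).real A := by
    rw [hX.map_shift s]
  rwa [map_measureReal_apply (measurable_pi_lambda _ fun t => hX.measurable _) hA',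
    map_measureReal_apply (measurable_pi_lambda _ fun t => hX.measurable _) hA'] at h1

end IsStationaryMarkov

/-! ### Correlation inequalities and the product bound -/

section Mixing

namespace IsStationaryMarkov

variable {S Ω : Type*} [MeasurableSpace S] [MeasurableSpace Ω] {π : Measure S}
  [IsProbabilityMeasure π] {K : MarkovSemigroup S} {P : Measure Ω} [IsProbabilityMeasure P]
  {X : ℝ → Ω → S} {δ : ℝ}

/-- The correlation inequality for a function `g` of the path before time `b` and a function `h`
of the path after time `a ≥ b`. -/
theorem lintegral_mul_le (hX : IsStationaryMarkov K π X P) (hrev : K.IsReversible π)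
    (hcont : StronglyContinuousAtZero (K.operator π hrev)) (hδ : 0 < δ)
    (hgap : HasSpectralGap (generator (K.operator π hrev)) δ) {b a : ℝ} (hba : b ≤ a)
    {g h : Ω → ℝ≥0∞} (hg : Measurable[pathSigma X (Set.Iic b)] g)
    (hh : Measurable[pathSigma X (Set.Ici a)] h) {C D : ℝ≥0} (hC : ∀ ω, g ω ≤ C)
    (hD : ∀ ω, h ω ≤ D) :
    (∫⁻ ω, g ω * h ω ∂P).toReal ≤ (∫⁻ ω, g ω ∂P).toReal * (∫⁻ ω, h ω ∂P).toReal +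
      Real.exp (-δ * (a - b)) * (lintegralNorm P g * lintegralNorm P h -
        (∫⁻ ω, g ω ∂P).toReal * (∫⁻ ω, h ω ∂P).toReal) := by
  have hg' : Measurable g := hg.mono (pathSigma_le hX.measurable _) le_rfl
  have hh' : Measurable h := hh.mono (pathSigma_le hX.measurable _) le_rfl
  obtain ⟨φ, hφ, hφD, hφu, hφN⟩ := hX.exists_condExp_factor a hh' hD
  obtain ⟨ψ, hψ, hψC, hψu, hψN⟩ := hX.exists_condExp_factor b hg' hC
  have hga : Measurable[pathSigma X (Set.Iic a)] g :=
    hg.mono (pathSigma_mono X (Set.Iic_subset_Iic.2 hba)) le_rfl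
  obtain ⟨χ, hχ, -, hχh⟩ := hX.exists_condExp_future a hga hC
  have hφa : Measurable[pathSigma X (Set.Ici a)] fun ω => φ (X a ω) :=
    hφ.comp (measurable_pathSigma X Set.self_mem_Ici)
  -- Conditioning replaces `h` by a function of `X a`, and then `g` by a function of `X b`.
  have h1 : ∫⁻ ω, g ω * h ω ∂P = ∫⁻ ω, g ω * φ (X a ω) ∂P := by
    rw [hχh h hh, hχh _ hφa, hX.lintegral_comp a (u := fun x => χ x * φ x) (hχ.mul hφ)]
    simp_rw [mul_comm (χ _)]
    rw [hφu χ hχ]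
  have h2 : ∫⁻ ω, g ω * φ (X a ω) ∂P =
      ∫⁻ x, ψ x * ∫⁻ y, φ y ∂K.kernel (a - b).toNNReal x ∂π := by
    have := hX.lintegral_mul_comp_add b (a - b).toNNReal hφ hg
    rw [Real.coe_toNNReal _ (by linarith), add_sub_cancel] at this
    rw [this, hψu _ hφ.lintegral_kernel]
  have h3 : ∫⁻ ω, g ω ∂P = ∫⁻ x, ψ x ∂π := by
    simpa using hψu (fun _ => 1) measurable_const
  have h4 : ∫⁻ ω, h ω ∂P = ∫⁻ x, φ x ∂π := by
    simpa using hφu (fun _ => 1) measurable_const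
  have key := lintegral_mul_lintegral_kernel_le K hrev hcont hδ hgap (a - b).toNNReal hψ hφ
    hψC hφD
  rw [Real.coe_toNNReal _ (by linarith)] at key
  rw [h1, h2, h3, h4]
  refine key.trans ?_
  gcongr
  · exact lintegralNorm_nonneg _ _
  · exact lintegralNorm_nonneg _ _

/-- The correlation inequality for functions that vanish outside `A` and outside `B`, whose means
are bounded by their norms times `√(P A)` and `√(P B)`. -/
theorem lintegral_mul_indicator_mul_indicator_le (hX : IsStationaryMarkov K π X P)
    (hrev : K.IsReversible π) (hcont : StronglyContinuousAtZero (K.operator π hrev))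
    (hδ : 0 < δ) (hgap : HasSpectralGap (generator (K.operator π hrev)) δ) {b a : ℝ}
    (hba : b ≤ a) {g h : Ω → ℝ≥0∞} (hg : Measurable[pathSigma X (Set.Iic b)] g)
    (hh : Measurable[pathSigma X (Set.Ici a)] h) {C D : ℝ≥0} (hC : ∀ ω, g ω ≤ C)
    (hD : ∀ ω, h ω ≤ D) {A B : Set Ω} (hA : MeasurableSet[pathSigma X (Set.Iic b)] A)
    (hB : MeasurableSet[pathSigma X (Set.Ici a)] B) :
    (∫⁻ ω, g ω * A.indicator 1 ω * (h ω * B.indicator 1 ω) ∂P).toReal ≤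
      (√(P.real A) * √(P.real B) +
        Real.exp (-δ * (a - b)) * (1 - √(P.real A) * √(P.real B))) *
      (lintegralNorm P (fun ω => g ω * A.indicator 1 ω) *
        lintegralNorm P (fun ω => h ω * B.indicator 1 ω)) := by
  have hmle := pathSigma_le hX.measurable
  have key := hX.lintegral_mul_le hrev hcont hδ hgap hba
    (measurable_mul_indicator_one hg hA) (measurable_mul_indicator_one hh hB)
    (C := C) (D := D)
    (fun ω => (mul_le_mul' (hC ω) (indicator_one_le A ω)).trans (by simp))
    (fun ω => (mul_le_mul' (hD ω) (indicator_one_le B ω)).trans (by simp))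
  have h1 := lintegral_mul_indicator_le (μ := P) (hg.mono (hmle _) le_rfl) hC (hmle _ _ hA)
  have h2 := lintegral_mul_indicator_le (μ := P) (hh.mono (hmle _) le_rfl) hD (hmle _ _ hB)
  have h3 := mul_le_mul h1 h2 ENNReal.toReal_nonneg
    (mul_nonneg (lintegralNorm_nonneg _ _) (Real.sqrt_nonneg _))
  have h4 : Real.exp (-δ * (a - b)) ≤ 1 := by
    rw [Real.exp_le_one_iff, neg_mul]
    have := mul_nonneg hδ.le (sub_nonneg.2 hba)
    linarith
  refine key.trans ?_
  have h5 := mul_le_mul_of_nonneg_left h3 (sub_nonneg.2 h4)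
  linarith

/-- The product bound for `k + 1` events in consecutive time intervals, weighted with a function
`g` of the path before the end of the first interval. -/
theorem lintegral_mul_indicator_iInter_le (hX : IsStationaryMarkov K π X P)
    (hrev : K.IsReversible π) (hcont : StronglyContinuousAtZero (K.operator π hrev))
    (hδ : 0 < δ) (hgap : HasSpectralGap (generator (K.operator π hrev)) δ) (k : ℕ) :
    ∀ (a b : Fin (k + 1) → EReal), (∀ i, a i < b i) →
      (∀ i : Fin k, b i.castSucc ≤ a i.succ) →
      ∀ A : Fin (k + 1) → Set Ω,
        (∀ i, MeasurableSet[pathSigma X {t : ℝ | a i ≤ (t : EReal) ∧ (t : EReal) ≤ b i}] (A i)) →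
      ∀ (g : Ω → ℝ≥0∞) (C : ℝ≥0), Measurable[pathSigma X {t : ℝ | (t : EReal) ≤ b 0}] g →
        (∀ ω, g ω ≤ C) →
        (∫⁻ ω, g ω * (⋂ i, A i).indicator 1 ω ∂P).toReal ≤
          lintegralNorm P (fun ω => g ω * (A 0).indicator 1 ω) * √(P.real (A (Fin.last k))) *
          ∏ i : Fin k, (√(P.real (A i.castSucc)) * √(P.real (A i.succ)) +
            Real.exp (-δ * (a i.succ - b i.castSucc).toReal) *
              (1 - √(P.real (A i.castSucc)) * √(P.real (A i.succ)))) := by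
  have hmle := pathSigma_le hX.measurable
  induction k with
  | zero =>
    intro a b hab hba A hA g C hg hC
    have h1 : ⋂ i, A i = A 0 := by simp [Set.iInter_eq_const, Fin.fin_one_eq_zero]
    rw [h1]
    simpa using lintegral_mul_indicator_le (μ := P) (hg.mono (hmle _) le_rfl) hC
      (hmle _ _ (hA 0))
  | succ k ih =>
    intro a b hab hba A hA g C hg hC
    -- The end points next to the first gap are finite.
    obtain ⟨β, hβ⟩ : ∃ β : ℝ, b 0 = β := by
      have h1 : b 0 ≠ ⊤ := ((hba 0).trans_lt ((hab _).trans_le le_top)).ne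
      have h2 : b 0 ≠ ⊥ := (bot_le.trans_lt (hab 0)).ne'
      exact ⟨(b 0).toReal, (EReal.coe_toReal h1 h2).symm⟩
    obtain ⟨α, hα⟩ : ∃ α : ℝ, a (Fin.succ 0) = α := by
      have h1 : a (Fin.succ 0) ≠ ⊤ := ((hab _).trans_le le_top).ne
      have h2 : a (Fin.succ 0) ≠ ⊥ :=
        (((bot_le.trans_lt (hab 0)).trans_le (hba 0))).ne'
      exact ⟨(a (Fin.succ 0)).toReal, (EReal.coe_toReal h1 h2).symm⟩
    have hβα : β ≤ α := by
      have := hba 0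
      rw [Fin.castSucc_zero, hβ, hα] at this
      exact_mod_cast this
    have hIicβ : {t : ℝ | (t : EReal) ≤ b 0} = Set.Iic β := by
      ext t; simp [hβ]
    rw [hIicβ] at hg
    have hA0 : MeasurableSet[pathSigma X (Set.Iic β)] (A 0) := by
      refine pathSigma_mono X (fun t ht => ?_) _ (hA 0)
      rw [← hIicβ]; exact ht.2
    have hαa : ∀ i : Fin (k + 1), (α : EReal) ≤ a i.succ := by
      intro i
      induction i using Fin.induction with
      | zero => exact hα.ge
      | succ i ih =>
        refine ih.trans ((hab _).le.trans ?_)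
        simpa using hba i.succ
    have hAsucc : ∀ i : Fin (k + 1), MeasurableSet[pathSigma X (Set.Ici α)] (A i.succ) := by
      intro i
      refine pathSigma_mono X (fun t ht => ?_) _ (hA i.succ)
      have := (hαa i).trans ht.1
      exact_mod_cast this
    -- Replace `g` on `A 0` by its conditional expectation given the path from time `α` on.
    have hg0 : Measurable[pathSigma X (Set.Iic β)] fun ω => g ω * (A 0).indicator 1 ω :=
      measurable_mul_indicator_one hg hA0
    have hg0C : ∀ ω, g ω * (A 0).indicator 1 ω ≤ C := fun ω =>
      (mul_le_mul' (hC ω) (indicator_one_le _ ω)).trans (by simp)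
    obtain ⟨ψ, hψ, hψC, hψh⟩ := hX.exists_condExp_future α
      (hg0.mono (pathSigma_mono X (Set.Iic_subset_Iic.2 hβα)) le_rfl) hg0C
    have hψα : Measurable[pathSigma X (Set.Ici α)] fun ω => ψ (X α ω) :=
      hψ.comp (measurable_pathSigma X Set.self_mem_Ici)
    have hstep : ∫⁻ ω, g ω * (⋂ i, A i).indicator 1 ω ∂P =
        ∫⁻ ω, ψ (X α ω) * (⋂ i : Fin (k + 1), A i.succ).indicator 1 ω ∂P := by
      rw [← hψh _ (measurable_indicator_one (MeasurableSet.iInter hAsucc))]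
      refine lintegral_congr fun ω => ?_
      have h1 : ⋂ i, A i = A 0 ∩ ⋂ i : Fin (k + 1), A i.succ := by
        ext ω; simp [Fin.forall_fin_succ]
      rw [h1, Set.inter_indicator_one, Pi.mul_apply, mul_assoc]
    have hih := ih (fun i => a i.succ) (fun i => b i.succ) (fun i => hab _)
      (fun i => by simpa using hba i.succ) (fun i => A i.succ) (fun i => hA _)
      (fun ω => ψ (X α ω)) C (hψ.comp (measurable_pathSigma X (by
        have := (hab (Fin.succ 0)).le
        rwa [hα] at this))) (fun ω => hψC _)
    -- One factor of the product bounds the norm of the conditional expectation on `A 1`.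
    have hnorm : lintegralNorm P (fun ω => ψ (X α ω) * (A (Fin.succ 0)).indicator 1 ω) ≤
        (√(P.real (A 0)) * √(P.real (A (Fin.succ 0))) + Real.exp (-δ * (α - β)) *
          (1 - √(P.real (A 0)) * √(P.real (A (Fin.succ 0))))) *
        lintegralNorm P (fun ω => g ω * (A 0).indicator 1 ω) := by
      have h1 := hX.lintegral_mul_indicator_mul_indicator_le hrev hcont hδ hgap hβα hg hψα hC
        (fun ω => hψC (X α ω)) hA0 (hAsucc 0)
      rw [hψh _ (measurable_mul_indicator_one hψα (hAsucc 0))] at h1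
      have h2 : ∫⁻ ω, ψ (X α ω) * (ψ (X α ω) * (A (Fin.succ 0)).indicator 1 ω) ∂P =
          ∫⁻ ω, ψ (X α ω) * (A (Fin.succ 0)).indicator 1 ω *
            (ψ (X α ω) * (A (Fin.succ 0)).indicator 1 ω) ∂P := by
        refine lintegral_congr fun ω => ?_
        rcases Set.indicator_eq_zero_or_self (A (Fin.succ 0)) (1 : Ω → ℝ≥0∞) ω with h | h <;>
          rw [h] <;> simp
      rw [h2, ← lintegralNorm_sq, sq, ← mul_assoc] at h1
      rcases (lintegralNorm_nonneg P
        (fun ω => ψ (X α ω) * (A (Fin.succ 0)).indicator 1 ω)).eq_or_lt with h0 | h0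
      · rw [← h0]
        have h3 : √(P.real (A 0)) * √(P.real (A (Fin.succ 0))) ≤ 1 :=
          mul_le_one₀ (Real.sqrt_le_one.2 measureReal_le_one) (Real.sqrt_nonneg _)
            (Real.sqrt_le_one.2 measureReal_le_one)
        exact mul_nonneg (add_nonneg (by positivity)
          (mul_nonneg (Real.exp_pos _).le (sub_nonneg.2 h3))) (lintegralNorm_nonneg _ _)
      · exact le_of_mul_le_mul_right h1 h0
    have hprod : 0 ≤ ∏ i : Fin k, (√(P.real (A i.castSucc.succ)) * √(P.real (A i.succ.succ)) +
        Real.exp (-δ * (a i.succ.succ - b i.castSucc.succ).toReal) *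
          (1 - √(P.real (A i.castSucc.succ)) * √(P.real (A i.succ.succ)))) := by
      refine Finset.prod_nonneg fun i _ => ?_
      have h3 : √(P.real (A i.castSucc.succ)) * √(P.real (A i.succ.succ)) ≤ 1 :=
        mul_le_one₀ (Real.sqrt_le_one.2 measureReal_le_one) (Real.sqrt_nonneg _)
          (Real.sqrt_le_one.2 measureReal_le_one)
      exact add_nonneg (by positivity) (mul_nonneg (Real.exp_pos _).le (sub_nonneg.2 h3))
    rw [hstep]
    refine hih.trans ?_
    rw [Fin.prod_univ_succ, Fin.castSucc_zero, hβ, hα, ← EReal.coe_sub, EReal.toReal_coe]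
    simp only [Fin.castSucc_succ, Fin.succ_last]
    calc _ ≤ _ := mul_le_mul_of_nonneg_right
          (mul_le_mul_of_nonneg_right hnorm (Real.sqrt_nonneg _)) hprod
      _ = _ := by ring

theorem measure_iInter_le (hX : IsStationaryMarkov K π X P)
    (hrev : K.IsReversible π) (hcont : StronglyContinuousAtZero (K.operator π hrev))
    (hδ : 0 < δ) (hgap : HasSpectralGap (generator (K.operator π hrev)) δ) (k : ℕ)
    (a b : Fin (k + 1) → EReal) (hab : ∀ i, a i < b i)
    (hba : ∀ i : Fin k, b i.castSucc ≤ a i.succ) (A : Fin (k + 1) → Set Ω)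
    (hA : ∀ i, MeasurableSet[pathSigma X {t : ℝ | a i ≤ (t : EReal) ∧ (t : EReal) ≤ b i}] (A i)) :
    P.real (⋂ i, A i) ≤ √(P.real (A 0)) * √(P.real (A (Fin.last k))) *
      ∏ i : Fin k, (√(P.real (A i.castSucc)) * √(P.real (A i.succ)) +
        Real.exp (-δ * (a i.succ - b i.castSucc).toReal) *
          (1 - √(P.real (A i.castSucc)) * √(P.real (A i.succ)))) := by
  have hm : ∀ i, MeasurableSet (A i) := fun i => pathSigma_le hX.measurable _ _ (hA i)
  have key := hX.lintegral_mul_indicator_iInter_le hrev hcont hδ hgap k a b hab hba A hA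
    (fun _ => 1) 1 measurable_const (fun _ => by simp)
  simp only [one_mul] at key
  rwa [lintegral_indicator_one (MeasurableSet.iInter hm),
    show (fun ω => (A 0).indicator (1 : Ω → ℝ≥0∞) ω) = (A 0).indicator 1 from rfl,
    lintegralNorm_indicator_one (hm 0)] at key

end IsStationaryMarkov

end Mixing

theorem theorem2 {S Ω : Type*} [MeasurableSpace S] [MeasurableSpace Ω]
    (π : Measure S) [IsProbabilityMeasure π]
    (K : MarkovSemigroup S) (hrev : K.IsReversible π)
    (hcont : StronglyContinuousAtZero (K.operator π hrev))
    (δ : ℝ) (hδ : 0 < δ) (hgap : HasSpectralGap (generator (K.operator π hrev)) δ)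
    (P : Measure Ω) [IsProbabilityMeasure P]
    (X : ℝ → Ω → S) (hX : IsStationaryMarkov K π X P)
    (k : ℕ) (hk : 1 ≤ k) :
    -- The intervals are `[a i, b i]`, with end points in `[-∞, ∞]`; the inequalities leave only
    -- `a 0 = -∞` and `b k = ∞` as possible infinite values.
    (∀ (a b : Fin (k + 1) → EReal), (∀ i, a i < b i) →
      (∀ i : Fin k, b i.castSucc ≤ a i.succ) →
      ∀ A : Fin (k + 1) → Set Ω,
        (∀ i, MeasurableSet[pathSigma X {t : ℝ | a i ≤ (t : EReal) ∧ (t : EReal) ≤ b i}] (A i)) →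
        P.real (⋂ i, A i) ≤ √(P.real (A 0)) * √(P.real (A (Fin.last k))) *
          ∏ i : Fin k, (√(P.real (A i.castSucc)) * √(P.real (A i.succ)) +
            Real.exp (-δ * (a i.succ - b i.castSucc).toReal) *
              (1 - √(P.real (A i.castSucc)) * √(P.real (A i.succ))))) ∧
    -- Time-shifted copies of one event `A`, a set of paths that depends on the times in `[a, b]`.
    (∀ (a b : ℝ), a < b → ∀ A : Set (ℝ → S),
      MeasurableSet[pathSigma (fun t (x : ℝ → S) => x t) (Set.Icc a b)] A →
      ∀ p : ℝ, P.real {ω | (fun t => X t ω) ∈ A} = p →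
      ∀ (s : Fin (k + 1) → ℝ) (t : Fin k → ℝ),
        (∀ i, t i = s i.succ - s i.castSucc - (b - a)) → (∀ i, 0 ≤ t i) →
        P.real {ω | ∀ i, (fun u => X (u + s i) ω) ∈ A} ≤
          p * ∏ i : Fin k, (p + Real.exp (-δ * t i) * (1 - p))) := by

  refine ⟨fun a b hab hba A hA => hX.measure_iInter_le hrev hcont hδ hgap k a b hab hba A hA,
    fun a b hab A hA p hp s t ht ht0 => ?_⟩
  have hshift : ∀ i, P.real {ω | (fun u => X (u + s i) ω) ∈ A} = p := fun i => by
    rw [hX.measure_shift (s i) hA, hp]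
  have hp0 : 0 ≤ p := hp ▸ measureReal_nonneg
  have key := hX.measure_iInter_le hrev hcont hδ hgap k
    (fun i => ((a + s i : ℝ) : EReal)) (fun i => ((b + s i : ℝ) : EReal))
    (fun i => by exact_mod_cast (by linarith : a + s i < b + s i))
    (fun i => by
      have h1 := ht0 i
      rw [ht i] at h1
      exact_mod_cast (by linarith : b + s i.castSucc ≤ a + s i.succ))
    (fun i => {ω | (fun u => X (u + s i) ω) ∈ A})
    (fun i => by
      have hI : {r : ℝ | ((a + s i : ℝ) : EReal) ≤ (r : EReal) ∧
          (r : EReal) ≤ ((b + s i : ℝ) : EReal)} = Set.Icc (a + s i) (b + s i) := by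
        ext r; simp only [Set.mem_ofPred_eq, EReal.coe_le_coe_iff, Set.mem_Icc]
      rw [hI]
      exact measurableSet_pathSigma_shift X (s i) hA)
  simp only [hshift, Real.mul_self_sqrt hp0, ← EReal.coe_sub, EReal.toReal_coe] at key
  have hset : {ω | ∀ i, (fun u => X (u + s i) ω) ∈ A} =
      ⋂ i, {ω | (fun u => X (u + s i) ω) ∈ A} := by
    ext ω; simp
  rw [hset]
  refine key.trans (le_of_eq ?_)
  congr 1
  refine Finset.prod_congr rfl fun i _ => ?_
  rw [ht i, show a + s i.succ - (b + s i.castSucc) = s i.succ - s i.castSucc - (b - a) by ring]
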